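/- **Theorem 5.4.** All manifolds are smooth, finite-dimensional and without boundary, and all metrics and curves are smooth. For a Riemannian manifold with Levi-Civita connection $\nabla$, let $\frac{D}{Dt}$ be the covariant derivative along curves and $R(X,Y)Z=\nabla_X\nabla_YZ-\nabla_Y\nabla_XZ-\nabla_{[X,Y]}Z$ the curvature. A *Riemannian cubic* is a curve $q(t)$, $t\in J$, on a non-degenerate interval $J\subseteq\mathbb R$, that satisfies $$\frac{D^3}{Dt^3}\dot q+R\Big(\frac{D}{Dt}\dot q,\dot q\Big)\dot q=0\quad\text{for all } t\in J .$$ Let $\Pi:\tilde Q\to Q$ be a Riemannian submersion, that is, a surjective submersion whose differential $T_x\Pi$ is isometric on the horizontal space $(\ker T_x\Pi)^{\perp}$ for every $x\in\tilde Q$. For horizontal vectors $\tilde v,\tilde w\in T_x\tilde Q$ put $[\tilde v,\tilde w]^V:=[\tilde V,\tilde W]^V(x)$, where $\tilde V,\tilde W$ are horizontal vector fields near $x$ with $\tilde V(x)=\tilde v$, $\tilde W(x)=\tilde w$, and $(\cdot)^V$ is the orthogonal projection onto the vertical space $\ker T_x\Pi$; this does not depend on the choice of $\tilde V,\tilde W$.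 Let $q:J\to Q$ be a Riemannian cubic and let $\tilde q:J\to\tilde Q$ be a horizontal lift of $q$, that is, $\Pi\circ\tilde q=q$ and $\dot{\tilde q}(t)$ is horizontal for all $t\in J$. Then $\frac{D}{Dt}\dot{\tilde q}(t)$ is horizontal for all $t\in J$, and $\tilde q$ is a Riemannian cubic if and only if $$\Big[\dot{\tilde q},\frac{D}{Dt}\dot{\tilde q}\Big]^V=0\quad\text{for all } t\in J .$$ -/

import Mathlib

open Bundle
open scoped Manifold ContDiff

noncomputable section

namespace RiemCubic

open VectorField FiberBundle

section LeviCivita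

variable {E : Type*} [NormedAddCommGroup E] [NormedSpace ℝ E] [FiniteDimensional ℝ E]
  {H : Type*} [TopologicalSpace H] {I : ModelWithCorners ℝ E H}
  {M : Type*} [TopologicalSpace M] [ChartedSpace H M] [IsManifold I ∞ M]
  [RiemannianBundle (fun x : M ↦ TangentSpace I x)]

/-- Right-hand side of the Koszul formula. -/
def koszul (X Y Z : Π x : M, TangentSpace I x) (x : M) : ℝ :=
  mvfderiv I (fun y ↦ inner ℝ (Y y) (Z y)) x (X x)
    + mvfderiv I (fun y ↦ inner ℝ (X y) (Z y)) x (Y x)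
    - mvfderiv I (fun y ↦ inner ℝ (X y) (Y y)) x (Z x)
    + inner ℝ (mlieBracket I X Y x) (Z x)
    - inner ℝ (mlieBracket I X Z x) (Y x)
    - inner ℝ (mlieBracket I Y Z x) (X x)

variable [IsContMDiffRiemannianBundle I ∞ E (fun x : M ↦ TangentSpace I x)]

theorem mdiffAt_inner {X Y : Π x : M, TangentSpace I x} {x : M}
    (hX : MDiffAt (T% X) x) (hY : MDiffAt (T% Y) x) :
    MDifferentiableAt I 𝓘(ℝ, ℝ) (fun y ↦ (inner ℝ (X y) (Y y) : ℝ)) x :=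
  MDifferentiableAt.inner_bundle (F := E) (E := fun x : M ↦ TangentSpace I x) (IB := I)
    (b := fun y : M ↦ y) hX hY

theorem koszul_tensorial_left {Y Z : Π x : M, TangentSpace I x} {x : M}
    (hY : MDiffAt (T% Y) x) (hZ : MDiffAt (T% Z) x) :
    TensorialAt I E (fun X : Π x : M, TangentSpace I x ↦ koszul X Y Z x) x where
  smul {f X} hf hX := by
    have h1 := mvfderiv_fun_mul hf (mdiffAt_inner hX hZ)
    have h2 := mvfderiv_fun_mul hf (mdiffAt_inner hX hY)
    simp only [koszul, Pi.smul_apply', real_inner_smul_left, real_inner_smul_right,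
      mlieBracket_smul_left hf hX, h1, h2, inner_add_left]
    simp
    rw [real_inner_comm (Z x) (X x), real_inner_comm (Y x) (X x)]
    ring
  add {X X'} hX hX' := by
    have h1 := mvfderiv_fun_add (mdiffAt_inner hX hZ) (mdiffAt_inner hX' hZ)
    have h2 := mvfderiv_fun_add (mdiffAt_inner hX hY) (mdiffAt_inner hX' hY)
    simp only [koszul, Pi.add_apply, mlieBracket_add_left hX hX', h1, h2,
      inner_add_left, inner_add_right, map_add, add_apply]
    ring

theorem koszul_tensorial_right {X Y : Π x : M, TangentSpace I x} {x : M}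
    (hX : MDiffAt (T% X) x) (hY : MDiffAt (T% Y) x) :
    TensorialAt I E (fun Z : Π x : M, TangentSpace I x ↦ koszul X Y Z x) x where
  smul {f Z} hf hZ := by
    have h1 := mvfderiv_fun_mul hf (mdiffAt_inner hY hZ)
    have h2 := mvfderiv_fun_mul hf (mdiffAt_inner hX hZ)
    simp only [koszul, Pi.smul_apply', real_inner_smul_right, real_inner_smul_left, mlieBracket_smul_right hf hZ, h1, h2,
      inner_add_left]
    simp
    rw [real_inner_comm (Z x) (X x), real_inner_comm (Z x) (Y x)]
    ring
  add {Z Z'} hZ hZ' := by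
    have h1 := mvfderiv_fun_add (mdiffAt_inner hY hZ) (mdiffAt_inner hY hZ')
    have h2 := mvfderiv_fun_add (mdiffAt_inner hX hZ) (mdiffAt_inner hX hZ')
    simp only [koszul, Pi.add_apply, mlieBracket_add_right hZ hZ', h1, h2,
      inner_add_left, inner_add_right, map_add, add_apply]
    ring

/-- For `Y` differentiable at `x`, the Koszul expression as a bilinear form in `(X x, Z x)`. -/
def koszulForm (Y : Π x : M, TangentSpace I x) (x : M) (hY : MDiffAt (T% Y) x) :
    TangentSpace I x →L[ℝ] TangentSpace I x →L[ℝ] ℝ :=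
  TensorialAt.mkHom₂ (I := I) (F := E) (F' := E) (fun X Z ↦ koszul X Y Z x) x
    (fun _ hZ ↦ koszul_tensorial_left hY hZ) (fun _ hX ↦ koszul_tensorial_right hX hY)

instance instFD (x : M) : FiniteDimensional ℝ (TangentSpace I x) :=
  inferInstanceAs (FiniteDimensional ℝ E)

instance instCS (x : M) : CompleteSpace (TangentSpace I x) := FiniteDimensional.complete ℝ _

open Classical in
/-- `∇Y` at `x`, defined by `2⟪∇_X Y, Z⟫ = koszul X Y Z` (zero if `Y` is not differentiable). -/
def leviCivitaFun (Y : Π x : M, TangentSpace I x) (x : M) : TangentSpace I x →L[ℝ] TangentSpace I x :=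
  if hY : MDiffAt (T% Y) x then
    (2⁻¹ : ℝ) • InnerProductSpace.continuousLinearMapOfBilin (𝕜 := ℝ) (koszulForm Y x hY)
  else 0

theorem inner_leviCivitaFun {X Y Z : Π x : M, TangentSpace I x} {x : M} (hX : MDiffAt (T% X) x)
    (hY : MDiffAt (T% Y) x) (hZ : MDiffAt (T% Z) x) :
    2 * inner ℝ (leviCivitaFun Y x (X x)) (Z x) = koszul X Y Z x := by
  rw [leviCivitaFun, dif_pos hY]
  simp [real_inner_smul_left, koszulForm]
  rw [TensorialAt.mkHom₂_apply _ _ hX hZ]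

theorem ext_inner {x : M} {u v : TangentSpace I x}
    (h : ∀ Z : Π x : M, TangentSpace I x, MDiffAt (T% Z) x →
      2 * inner ℝ u (Z x) = 2 * inner ℝ v (Z x)) : u = v := by
  refine ext_inner_right ℝ fun w ↦ ?_
  have := h (extend E w) (mdifferentiableAt_extend I E w)
  rw [extend_apply_self] at this
  linarith

theorem koszul_add {X Y Y' Z : Π x : M, TangentSpace I x} {x : M} (hX : MDiffAt (T% X) x)
    (hY : MDiffAt (T% Y) x) (hY' : MDiffAt (T% Y') x) (hZ : MDiffAt (T% Z) x) :
    koszul X (Y + Y') Z x = koszul X Y Z x + koszul X Y' Z x := by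
  have h1 := mvfderiv_fun_add (mdiffAt_inner hY hZ) (mdiffAt_inner hY' hZ)
  have h2 := mvfderiv_fun_add (mdiffAt_inner hX hY) (mdiffAt_inner hX hY')
  simp only [koszul, Pi.add_apply, mlieBracket_add_right hY hY', mlieBracket_add_left hY hY', h1,
    h2, inner_add_left, inner_add_right, map_add, add_apply]
  ring

theorem koszul_smul {f : M → ℝ} {X Y Z : Π x : M, TangentSpace I x} {x : M}
    (hX : MDiffAt (T% X) x) (hf : MDiffAt f x) (hY : MDiffAt (T% Y) x) (hZ : MDiffAt (T% Z) x) :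
    koszul X (f • Y) Z x
      = f x * koszul X Y Z x + 2 * (mvfderiv I f x (X x) * inner ℝ (Y x) (Z x)) := by
  have h1 := mvfderiv_fun_mul hf (mdiffAt_inner hY hZ)
  have h2 := mvfderiv_fun_mul hf (mdiffAt_inner hX hY)
  simp only [koszul, Pi.smul_apply', real_inner_smul_left, real_inner_smul_right,
    mlieBracket_smul_left hf hY, mlieBracket_smul_right hf hY, h1, h2, inner_add_left]
  simp
  rw [real_inner_comm (X x) (Y x)]
  ring

variable (I M) in
/-- The Levi-Civita connection of a Riemannian manifold. `leviCivita I M Y x u` is `(∇_u Y)(x)`. -/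
def leviCivita : CovariantDerivative I E (fun x : M ↦ TangentSpace I x) where
  toFun := leviCivitaFun
  isCovariantDerivativeOnUniv :=
    { add := by
        intro Y Y' x hY hY' _
        ext u
        refine ext_inner fun Z hZ ↦ ?_
        have hX := mdifferentiableAt_extend I E u
        have e := extend_apply_self E u
        conv_lhs => rw [← e]
        conv_rhs => rw [← e]
        rw [add_apply, inner_add_left, mul_add, inner_leviCivitaFun hX hY hZ, inner_leviCivitaFun hX hY' hZ,
          inner_leviCivitaFun hX (mdifferentiableAt_add_section hY hY') hZ, koszul_add hX hY hY' hZ]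
      leibniz := by
        intro Y f x hY hf _
        ext u
        refine ext_inner fun Z hZ ↦ ?_
        have hX := mdifferentiableAt_extend I E u
        have e := extend_apply_self E u
        conv_lhs => rw [← e]
        conv_rhs => rw [← e]
        rw [inner_leviCivitaFun hX (hf.smul_section hY) hZ, koszul_smul hX hf hY hZ, ← inner_leviCivitaFun hX hY hZ]
        simp [inner_add_left, real_inner_smul_left]
        ring }

theorem leviCivita_torsion : (leviCivita I M).torsion = 0 := by
  rw [CovariantDerivative.torsion_eq_zero_iff]
  intro X Y x hX hY
  refine ext_inner fun Z hZ ↦ ?_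
  change 2 * inner ℝ (leviCivitaFun Y x (X x) - leviCivitaFun X x (Y x)) (Z x) = _
  rw [inner_sub_left, mul_sub, inner_leviCivitaFun hX hY hZ, inner_leviCivitaFun hY hX hZ]
  simp only [koszul, mlieBracket_swap_apply (V := Y) (W := X), inner_neg_left, real_inner_comm]
  ring

theorem leviCivita_metric {x : M} {Y Z : Π x : M, TangentSpace I x} (hY : MDiffAt (T% Y) x)
    (hZ : MDiffAt (T% Z) x) (u : TangentSpace I x) :
    mvfderiv I (fun y ↦ (inner ℝ (Y y) (Z y) : ℝ)) x u
      = inner ℝ (leviCivita I M Y x u) (Z x) + inner ℝ (Y x) (leviCivita I M Z x u) := by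
  change _ = inner ℝ (leviCivitaFun Y x u) (Z x) + inner ℝ (Y x) (leviCivitaFun Z x u)
  have hX := mdifferentiableAt_extend I E u
  have h1 := inner_leviCivitaFun hX hY hZ
  have h2 := inner_leviCivitaFun hX hZ hY
  rw [real_inner_comm (leviCivitaFun Z x u) (Y x)]
  simp only [koszul, mlieBracket_swap_apply (V := Z) (W := Y), inner_neg_left,
    extend_apply_self] at h1 h2
  have e : (fun y ↦ (inner ℝ (Z y) (Y y) : ℝ)) = fun y ↦ inner ℝ (Y y) (Z y) :=
    funext fun y ↦ real_inner_comm _ _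
  rw [e] at h2
  linarith

end LeviCivita

section Velocity

variable {E : Type*} [NormedAddCommGroup E] [NormedSpace ℝ E]
  {H : Type*} [TopologicalSpace H] (I : ModelWithCorners ℝ E H)
  {M : Type*} [TopologicalSpace M] [ChartedSpace H M]

/-- The velocity of a curve `q` defined on the interval `J` (one-sided at end points of `J`). -/
def velocity (J : Set ℝ) (q : ℝ → M) (t : ℝ) : TangentSpace I (q t) :=
  mfderivWithin 𝓘(ℝ, ℝ) I q J t (1 : ℝ)

end Velocity

section Curves

variable {E : Type*} [NormedAddCommGroup E] [NormedSpace ℝ E] [FiniteDimensional ℝ E]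
  {H : Type*} [TopologicalSpace H] (I : ModelWithCorners ℝ E H)
  {M : Type*} [TopologicalSpace M] [ChartedSpace H M] [IsManifold I ∞ M]
  [RiemannianBundle (fun x : M ↦ TangentSpace I x)]
  [IsContMDiffRiemannianBundle I ∞ E (fun x : M ↦ TangentSpace I x)]

/-- The curvature tensor `R(u, v) w = ∇_X ∇_Y Z - ∇_Y ∇_X Z - ∇_[X,Y] Z` of the Levi-Civita
connection, evaluated with the extensions `X, Y, Z` of the tangent vectors `u, v, w` at `x` that
have constant components in the preferred chart at `x`. -/
def curvature (x : M) (u v w : TangentSpace I x) : TangentSpace I x :=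
  let X : Π y : M, TangentSpace I y := extend E u
  let Y : Π y : M, TangentSpace I y := extend E v
  let Z : Π y : M, TangentSpace I y := extend E w
  leviCivita I M (fun y ↦ leviCivita I M Z y (Y y)) x (X x)
    - leviCivita I M (fun y ↦ leviCivita I M Z y (X y)) x (Y x)
    - leviCivita I M Z x (mlieBracket I X Y x)

/-- The covariant derivative `D/Dt V` of a vector field `V` along the curve `q : J → M`.
In the preferred chart at `q t`, with components `V = v^j ∂_j` and velocity `ẋ^i ∂_i`, it is
`(v̇^k + Γ^k_{ij} ẋ^i v^j) ∂_k`. The first summand differentiates the components of `V`; the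
second is `∇_{q̇} (v^j(t) ∂_j)` with coefficients frozen at time `t`, which equals
`Γ^k_{ij} ẋ^i v^j ∂_k` because `∇_{∂_i} ∂_j = Γ^k_{ij} ∂_k`. -/
def covDerivAlong (J : Set ℝ) (q : ℝ → M) (V : Π t : ℝ, TangentSpace I (q t)) (t : ℝ) :
    TangentSpace I (q t) :=
  let triv := trivializationAt E (fun x : M ↦ TangentSpace I x) (q t)
  triv.symmL ℝ (q t) (derivWithin (fun s ↦ triv.continuousLinearMapAt ℝ (q s) (V s)) J t)
    + leviCivita I M (extend E (V t)) (q t) (velocity I J q t)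

/-- A Riemannian cubic on the interval `J`: a smooth curve with
`D³/Dt³ q̇ + R(D/Dt q̇, q̇) q̇ = 0`. -/
structure IsRiemannianCubicOn (J : Set ℝ) (q : ℝ → M) : Prop where
  contMDiffOn : ContMDiffOn 𝓘(ℝ, ℝ) I ∞ q J
  eq_zero : ∀ t ∈ J,
    covDerivAlong I J q (covDerivAlong I J q (covDerivAlong I J q (velocity I J q))) t
      + curvature I (q t) (covDerivAlong I J q (velocity I J q) t) (velocity I J q t)
          (velocity I J q t) = 0

end Curves

section Submersion

variable {E : Type*} [NormedAddCommGroup E] [NormedSpace ℝ E] [FiniteDimensional ℝ E]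
  {H : Type*} [TopologicalSpace H] (I : ModelWithCorners ℝ E H)
  {M : Type*} [TopologicalSpace M] [ChartedSpace H M] [IsManifold I ∞ M]
  [RiemannianBundle (fun x : M ↦ TangentSpace I x)]
  {E' : Type*} [NormedAddCommGroup E'] [NormedSpace ℝ E']
  {H' : Type*} [TopologicalSpace H'] (I' : ModelWithCorners ℝ E' H')
  {N : Type*} [TopologicalSpace N] [ChartedSpace H' N]

/-- The vertical space `ker T_x p`. -/
def verticalSpace (p : M → N) (x : M) : Submodule ℝ (TangentSpace I x) :=
  LinearMap.ker (mfderiv I I' p x).toLinearMap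

/-- The horizontal space, the orthogonal complement of the vertical space. -/
def horizontalSpace (p : M → N) (x : M) : Submodule ℝ (TangentSpace I x) :=
  (verticalSpace I I' p x)ᗮ

/-- The smooth curve `q'` in `M` is a horizontal lift of the curve `q` in `N` on `J`. -/
structure IsHorizontalLiftOn (p : M → N) (J : Set ℝ) (q : ℝ → N) (q' : ℝ → M) : Prop where
  contMDiffOn : ContMDiffOn 𝓘(ℝ, ℝ) I ∞ q' J
  lift : ∀ t ∈ J, p (q' t) = q t
  horizontal : ∀ t ∈ J, velocity I J q' t ∈ horizontalSpace I I' p (q' t)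

/-- A local horizontal extension of a horizontal vector `v` at `x`: extend `v` with constant
components in the preferred chart at `x` and take the horizontal part at each point. -/
def horizontalExtend (p : M → N) {x : M} (v : TangentSpace I x) (y : M) : TangentSpace I y :=
  (horizontalSpace I I' p y).starProjection (extend E v y)

/-- The vertical part `[v, w]^V` of the bracket of two horizontal vectors at `x`, computed with
horizontal extensions of `v` and `w` (on which it does not depend). -/
def verticalBracket (p : M → N) (x : M) (v w : TangentSpace I x) : TangentSpace I x :=
  (verticalSpace I I' p x).starProjection
    (mlieBracket I (horizontalExtend I I' p v) (horizontalExtend I I' p w) x)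

/-- A Riemannian submersion: a smooth surjective submersion whose differential restricts to
an isometry on horizontal spaces. -/
structure IsRiemannianSubmersion [RiemannianBundle (fun x : N ↦ TangentSpace I' x)]
    (p : M → N) : Prop where
  contMDiff : ContMDiff I I' ∞ p
  surjective : Function.Surjective p
  mfderiv_surjective : ∀ x, Function.Surjective (mfderiv I I' p x)
  inner_eq : ∀ x, ∀ v ∈ horizontalSpace I I' p x, ∀ w ∈ horizontalSpace I I' p x,
    (inner ℝ v w : ℝ) = inner ℝ (mfderiv I I' p x v) (mfderiv I I' p x w)

end Submersion

end RiemCubic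

end

open RiemCubic

open Bundle
open scoped Manifold ContDiff
set_option linter.unusedSectionVars false

noncomputable section

namespace RiemCubic

open VectorField FiberBundle Filter
open scoped Topology

section Smoothness

variable {E : Type*} [NormedAddCommGroup E] [NormedSpace ℝ E]
  {H : Type*} [TopologicalSpace H] {I : ModelWithCorners ℝ E H}
  {M : Type*} [TopologicalSpace M] [ChartedSpace H M] [IsManifold I ∞ M]
  {E' : Type*} [NormedAddCommGroup E'] [NormedSpace ℝ E']
  {H' : Type*} [TopologicalSpace H'] {I' : ModelWithCorners ℝ E' H'}
  {N : Type*} [TopologicalSpace N] [ChartedSpace H' N] [IsManifold I' ∞ N]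

/-- The derivative of a smooth map along a smooth vector field is smooth. -/
theorem contMDiffAt_mfderiv_apply {f : M → N} {X : Π x : M, TangentSpace I x} {x : M}
    (hf : CMDiffAt ∞ f x) (hX : CMDiffAt ∞ (T% X) x) :
    ContMDiffAt I I'.tangent ∞
      (fun y ↦ (⟨f y, mfderiv I I' f y (X y)⟩ : TangentBundle I' N)) x :=
  ContMDiffAt.clm_apply_of_inCoordinates (b₁ := id) (b₂ := f)
    (hf.mfderiv_const (m := ∞) (by simp)) hX hf

theorem contMDiffAt_mvfderiv_apply {f : M → ℝ} {X : Π x : M, TangentSpace I x} {x : M}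
    (hf : CMDiffAt ∞ f x) (hX : CMDiffAt ∞ (T% X) x) :
    CMDiffAt ∞ (fun y ↦ mvfderiv I f y (X y)) x :=
  (contMDiff_snd_tangentBundle_modelSpace ℝ 𝓘(ℝ, ℝ)).contMDiffAt.comp x
    (contMDiffAt_mfderiv_apply hf hX)

theorem contMDiffAt_mlieBracket [CompleteSpace E] {X Y : Π x : M, TangentSpace I x} {x : M}
    (hX : CMDiffAt ∞ (T% X) x) (hY : CMDiffAt ∞ (T% Y) x) :
    CMDiffAt ∞ (T% (mlieBracket I X Y)) x := by
  have : IsManifold I (((⊤ : ℕ∞) : WithTop ℕ∞) + 1) M := ‹IsManifold I ∞ M›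
  have : IsManifold I (minSmoothness ℝ 2) M := .of_le (n := ∞) (by simpa using ENat.LEInfty.out)
  exact ContMDiffAt.mlieBracket_vectorField (n := ⊤) (m := ⊤) hX hY (by simp)

theorem eventually_mdiffAt {X : Π x : M, TangentSpace I x} {x : M}
    (hX : CMDiffAt ∞ (T% X) x) : ∀ᶠ y in 𝓝 x, MDiffAt (T% X) y := by
  have h : CMDiffAt 1 (T% X) x := hX.of_le (by simp)
  exact ((contMDiffAt_iff_contMDiffAt_nhds (by simp)).1 h).mono fun y hy ↦ hy.mdifferentiableAt (by simp)

theorem mdiffAt_of_smooth {X : Π x : M, TangentSpace I x} {x : M}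
    (hX : CMDiffAt ∞ (T% X) x) : MDiffAt (T% X) x := hX.mdifferentiableAt (by simp)

end Smoothness

section Weak

variable {E : Type*} [NormedAddCommGroup E] [NormedSpace ℝ E] [FiniteDimensional ℝ E]
  {H : Type*} [TopologicalSpace H] {I : ModelWithCorners ℝ E H}
  {M : Type*} [TopologicalSpace M] [ChartedSpace H M] [IsManifold I ∞ M]
  [RiemannianBundle (fun x : M ↦ TangentSpace I x)]
  [IsContMDiffRiemannianBundle I ∞ E (fun x : M ↦ TangentSpace I x)]

theorem contMDiffAt_inner {X Y : Π x : M, TangentSpace I x} {x : M}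
    (hX : CMDiffAt ∞ (T% X) x) (hY : CMDiffAt ∞ (T% Y) x) :
    CMDiffAt ∞ (fun y ↦ (inner ℝ (X y) (Y y) : ℝ)) x :=
  ContMDiffAt.inner_bundle (F := E) (E := fun x : M ↦ TangentSpace I x) (IB := I)
    (b := fun y : M ↦ y) hX hY

/-- A linear system with smooth coefficients, invertible at one point, has smooth solutions. -/
theorem contMDiffAt_of_linear_system {ι : Type*} [Fintype ι] {G : M → ι → ι → ℝ} {v b : M → ι → ℝ}
    {x : M} (hG : ∀ i j, CMDiffAt ∞ (fun y ↦ G y i j) x) (hb : ∀ i, CMDiffAt ∞ (fun y ↦ b y i) x)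
    (hx : ∀ w : ι → ℝ, (∀ i, ∑ j, G x i j * w j = 0) → w = 0)
    (h : ∀ᶠ y in 𝓝 x, ∀ i, ∑ j, G y i j * v y j = b y i) (j : ι) :
    CMDiffAt ∞ (fun y ↦ v y j) x := by
  classical
  let e (i j : ι) : (ι → ℝ) →L[ℝ] (ι → ℝ) :=
    (ContinuousLinearMap.proj (R := ℝ) (φ := fun _ : ι ↦ ℝ) j).smulRight (Pi.single i (1 : ℝ))
  let L (y : M) : (ι → ℝ) →L[ℝ] (ι → ℝ) := ∑ i, ∑ j, G y i j • e i j
  have hL (y : M) (w : ι → ℝ) (i : ι) : L y w i = ∑ j, G y i j * w j := by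
    simp only [L, e, FunLike.coe_sum, Finset.sum_apply, _root_.smul_apply,
      ContinuousLinearMap.smulRight_apply, ContinuousLinearMap.proj_apply, Pi.smul_apply,
      Pi.single_apply, smul_eq_mul]
    rw [Finset.sum_eq_single i]
    · simp
    · intro k _ hk
      simp [hk.symm]
    · simp
  have hLs : CMDiffAt ∞ L x := by
    refine ContMDiffAt.sum fun i _ ↦ ContMDiffAt.sum fun j _ ↦ ?_
    exact (hG i j).smul contMDiffAt_const
  have hinj : Function.Injective (L x) := by
    rw [injective_iff_map_eq_zero]
    intro w hw
    refine hx w fun i ↦ ?_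
    rw [← hL, hw, Pi.zero_apply]
  let φ : (ι → ℝ) ≃L[ℝ] (ι → ℝ) :=
    (LinearEquiv.ofInjectiveEndo (L x : (ι → ℝ) →ₗ[ℝ] (ι → ℝ)) hinj).toContinuousLinearEquiv
  have hφ : (φ : (ι → ℝ) →L[ℝ] (ι → ℝ)) = L x := by
    ext1 w
    rfl
  have hinv : CMDiffAt ∞ (fun y ↦ (L y).inverse) x := by
    have h1 : ContDiffAt ℝ ∞ ContinuousLinearMap.inverse (L x) := hφ ▸ contDiffAt_map_inverse φ
    exact h1.contMDiffAt.comp x hLs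
  have hbs : ContMDiffAt I 𝓘(ℝ, ι → ℝ) ∞ b x := contMDiffAt_pi_space.2 hb
  have hsol : ContMDiffAt I 𝓘(ℝ, ι → ℝ) ∞ (fun y ↦ (L y).inverse (b y)) x := hinv.clm_apply hbs
  have hev : ∀ᶠ y in 𝓝 x, ∃ ψ : (ι → ℝ) ≃L[ℝ] (ι → ℝ), (ψ : (ι → ℝ) →L[ℝ] (ι → ℝ)) = L y := by
    have : ∀ᶠ T in 𝓝 (L x), ∃ ψ : (ι → ℝ) ≃L[ℝ] (ι → ℝ), (ψ : (ι → ℝ) →L[ℝ] (ι → ℝ)) = T :=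
      hφ ▸ φ.nhds
    exact hLs.continuousAt.eventually this
  have : (fun y ↦ v y j) =ᶠ[𝓝 x] fun y ↦ (L y).inverse (b y) j := by
    filter_upwards [h, hev] with y hy hψ
    obtain ⟨ψ, hψ⟩ := hψ
    have : b y = ψ (v y) := by
      ext i
      rw [← hy i, ← hL, ← hψ]
      rfl
    rw [← hψ, this]
    simp
  exact (contMDiffAt_pi_space.1 hsol j).congr_of_eventuallyEq this

theorem contMDiffAt_of_inner {V : Π x : M, TangentSpace I x} {x : M}
    (h : ∀ Z : Π x : M, TangentSpace I x, CMDiffAt ∞ (T% Z) x →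
      CMDiffAt ∞ (fun y ↦ (inner ℝ (V y) (Z y) : ℝ)) x) :
    CMDiffAt ∞ (T% V) x := by
  let t := trivializationAt E (fun x : M ↦ TangentSpace I x) x
  have hx : x ∈ t.baseSet := mem_baseSet_trivializationAt' x
  let b := Module.finBasis ℝ E
  let s := t.localFrame b
  have hs (i) : CMDiffAt ∞ (T% (s i)) x := contMDiffAt_localFrame_of_mem ∞ t b i hx
  rw [contMDiffAt_iff_localFrameCoeff b hx]
  refine contMDiffAt_of_linear_system (G := fun y i j ↦ inner ℝ (s j y) (s i y))
    (v := fun y j ↦ t.localFrameCoeff I b j y (V y)) (b := fun y i ↦ inner ℝ (V y) (s i y))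
    (fun i j ↦ contMDiffAt_inner (hs j) (hs i)) (fun i ↦ h _ (hs i)) ?_ ?_
  · intro w hw
    have h0 : ∑ j, w j • s j x = 0 := by
      have key : ∀ i, (inner ℝ (∑ j, w j • s j x) (s i x) : ℝ) = 0 := fun i ↦ by
        rw [sum_inner, ← hw i]
        exact Finset.sum_congr rfl fun j _ ↦ by rw [real_inner_smul_left, mul_comm]
      rw [← inner_self_eq_zero (𝕜 := ℝ)]
      conv_lhs => rw [inner_sum]
      exact Finset.sum_eq_zero fun i _ ↦ by rw [real_inner_smul_right, key, mul_zero]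
    have hli := (t.isLocalFrameOn_localFrame_baseSet I ∞ b).linearIndependent hx
    rw [Fintype.linearIndependent_iff] at hli
    exact funext (hli w h0)
  · filter_upwards [t.eventually_eq_localFrame_sum_coeff_smul (s := V) (I := I) b hx] with y hy i
    conv_rhs => rw [hy, sum_inner]
    exact Finset.sum_congr rfl fun j _ ↦ by rw [real_inner_smul_left, mul_comm]

end Weak

section LeviCivitaCalculus

variable {E : Type*} [NormedAddCommGroup E] [NormedSpace ℝ E] [FiniteDimensional ℝ E]
  {H : Type*} [TopologicalSpace H] {I : ModelWithCorners ℝ E H}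
  {M : Type*} [TopologicalSpace M] [ChartedSpace H M] [IsManifold I ∞ M]
  [RiemannianBundle (fun x : M ↦ TangentSpace I x)]
  [IsContMDiffRiemannianBundle I ∞ E (fun x : M ↦ TangentSpace I x)]

theorem two_mul_inner_leviCivita {X Y Z : Π x : M, TangentSpace I x} {x : M}
    (hX : MDiffAt (T% X) x) (hY : MDiffAt (T% Y) x) (hZ : MDiffAt (T% Z) x) :
    2 * inner ℝ (leviCivita I M Y x (X x)) (Z x) = koszul X Y Z x :=
  inner_leviCivitaFun hX hY hZ

theorem contMDiffAt_koszul {X Y Z : Π x : M, TangentSpace I x} {x : M}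
    (hX : CMDiffAt ∞ (T% X) x) (hY : CMDiffAt ∞ (T% Y) x) (hZ : CMDiffAt ∞ (T% Z) x) :
    CMDiffAt ∞ (fun y ↦ koszul X Y Z y) x := by
  have := FiniteDimensional.complete ℝ E
  exact (((((contMDiffAt_mvfderiv_apply (contMDiffAt_inner hY hZ) hX).add
    (contMDiffAt_mvfderiv_apply (contMDiffAt_inner hX hZ) hY)).sub
    (contMDiffAt_mvfderiv_apply (contMDiffAt_inner hX hY) hZ)).add
    (contMDiffAt_inner (contMDiffAt_mlieBracket hX hY) hZ)).sub
    (contMDiffAt_inner (contMDiffAt_mlieBracket hX hZ) hY)).sub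
    (contMDiffAt_inner (contMDiffAt_mlieBracket hY hZ) hX)

/-- The Levi-Civita derivative of a smooth field along a smooth field is smooth. -/
theorem contMDiffAt_leviCivita {X Y : Π x : M, TangentSpace I x} {x : M}
    (hX : CMDiffAt ∞ (T% X) x) (hY : CMDiffAt ∞ (T% Y) x) :
    CMDiffAt ∞ (T% (fun y ↦ leviCivita I M Y y (X y))) x := by
  refine contMDiffAt_of_inner fun Z hZ ↦ ?_
  have h : CMDiffAt ∞ (fun y ↦ (2⁻¹ : ℝ) * koszul X Y Z y) x :=
    contMDiffAt_const.mul (contMDiffAt_koszul hX hY hZ)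
  refine h.congr_of_eventuallyEq ?_
  filter_upwards [eventually_mdiffAt hX, eventually_mdiffAt hY, eventually_mdiffAt hZ]
    with y h1 h2 h3
  rw [← two_mul_inner_leviCivita h1 h2 h3]
  ring

theorem leviCivita_add {Y Y' : Π x : M, TangentSpace I x} {x : M}
    (hY : MDiffAt (T% Y) x) (hY' : MDiffAt (T% Y') x) :
    leviCivita I M (Y + Y') x = leviCivita I M Y x + leviCivita I M Y' x :=
  (leviCivita I M).isCovariantDerivativeOnUniv.add hY hY'

theorem leviCivita_smul {f : M → ℝ} {Y : Π x : M, TangentSpace I x} {x : M}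
    (hf : MDiffAt f x) (hY : MDiffAt (T% Y) x) (u : TangentSpace I x) :
    leviCivita I M (f • Y) x u = f x • leviCivita I M Y x u + mvfderiv I f x u • Y x := by
  rw [(leviCivita I M).isCovariantDerivativeOnUniv.leibniz hY hf]
  simp

theorem leviCivita_congr {Y Y' : Π x : M, TangentSpace I x} {x : M}
    (hY : MDiffAt (T% Y) x) (h : ∀ᶠ y in 𝓝 x, Y y = Y' y) :
    leviCivita I M Y x = leviCivita I M Y' x := by
  refine (leviCivita I M).isCovariantDerivativeOnUniv.congr_of_eventuallyEq hY ?_ univ_mem h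
  refine hY.congr_of_eventuallyEq ?_
  filter_upwards [h] with y hy
  rw [hy]

theorem leviCivita_sum_smul {ι : Type*} (s : Finset ι) {c : ι → M → ℝ}
    {X : ι → Π x : M, TangentSpace I x} {x : M}
    (hc : ∀ i ∈ s, MDiffAt (c i) x) (hX : ∀ i ∈ s, MDiffAt (T% (X i)) x) (u : TangentSpace I x) :
    leviCivita I M (fun y ↦ ∑ i ∈ s, c i y • X i y) x u
      = ∑ i ∈ s, (c i x • leviCivita I M (X i) x u + mvfderiv I (c i) x u • X i x) := by
  classical
  induction s using Finset.induction_on with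
  | empty =>
    simp only [Finset.sum_empty]
    exact congrArg (fun T ↦ T u) ((leviCivita I M).isCovariantDerivativeOnUniv.zero (x := x))
  | insert a s ha ih =>
    simp only [Finset.mem_insert, forall_eq_or_imp] at hc hX
    rw [Finset.sum_insert ha, ← ih hc.2 hX.2, ← leviCivita_smul hc.1 hX.1]
    have h1 : MDiffAt (T% (c a • X a)) x := hc.1.smul_section hX.1
    have h2 : MDiffAt (T% (fun y ↦ ∑ i ∈ s, c i y • X i y)) x :=
      .sum_section fun i hi ↦ (hc.2 i hi).smul_section (hX.2 i hi)
    have e : (fun y ↦ ∑ i ∈ insert a s, c i y • X i y)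
        = c a • X a + fun y ↦ ∑ i ∈ s, c i y • X i y := by
      funext y
      simp [Finset.sum_insert ha]
    rw [e, leviCivita_add h1 h2]
    rfl

theorem leviCivita_sub_leviCivita {X Y : Π x : M, TangentSpace I x} {x : M}
    (hX : MDiffAt (T% X) x) (hY : MDiffAt (T% Y) x) :
    leviCivita I M Y x (X x) - leviCivita I M X x (Y x) = mlieBracket I X Y x :=
  (CovariantDerivative.torsion_eq_zero_iff _).1 leviCivita_torsion hX hY

end LeviCivitaCalculus

section Frames

variable {E : Type*} [NormedAddCommGroup E] [NormedSpace ℝ E] [FiniteDimensional ℝ E]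
  {H : Type*} [TopologicalSpace H] {I : ModelWithCorners ℝ E H}
  {M : Type*} [TopologicalSpace M] [ChartedSpace H M] [IsManifold I ∞ M]

variable (I) in
/-- The vector field with constant components `w` in the preferred chart at `x`. -/
def chartField (x : M) (w : E) (y : M) : TangentSpace I y :=
  (trivializationAt E (fun x : M ↦ TangentSpace I x) x).symmL ℝ y w

variable (I) in
/-- The components of a tangent vector at `y` in the preferred chart at `x`. -/
def chartCoord (x y : M) : TangentSpace I y →L[ℝ] E :=
  (trivializationAt E (fun x : M ↦ TangentSpace I x) x).continuousLinearMapAt ℝ y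

theorem extend_eventuallyEq_chartField {x : M} (v : TangentSpace I x) :
    ∀ᶠ y in 𝓝 x, extend E v y = chartField I x (chartCoord I x x v) y := by
  let t := trivializationAt E (fun x : M ↦ TangentSpace I x) x
  have hx : x ∈ t.baseSet := mem_baseSet_trivializationAt E (fun x : M ↦ TangentSpace I x) x
  filter_upwards [t.open_baseSet.mem_nhds hx] with y hy
  change t.symm y (t ⟨x, v⟩).2 = t.symmₗ ℝ y (t.linearMapAt ℝ x v)
  rw [t.coe_linearMapAt_of_mem hx, t.symmₗ_apply hy]

theorem chartField_chartCoord_self {x : M} (v : TangentSpace I x) :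
    chartField I x (chartCoord I x x v) x = v := by
  rw [← (extend_eventuallyEq_chartField v).self_of_nhds, extend_apply_self]

theorem chartField_chartCoord {x : M} : ∀ᶠ y in 𝓝 x, ∀ v : TangentSpace I y,
    chartField I x (chartCoord I x y v) y = v := by
  let t := trivializationAt E (fun x : M ↦ TangentSpace I x) x
  filter_upwards [t.open_baseSet.mem_nhds (mem_baseSet_trivializationAt' x)] with y hy v
  exact t.symmL_continuousLinearMapAt hy v

theorem chartCoord_chartField {x : M} : ∀ᶠ y in 𝓝 x, ∀ w : E,
    chartCoord I x y (chartField I x w y) = w := by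
  let t := trivializationAt E (fun x : M ↦ TangentSpace I x) x
  filter_upwards [t.open_baseSet.mem_nhds (mem_baseSet_trivializationAt' x)] with y hy v
  exact t.continuousLinearMapAt_symmL hy v

theorem chartCoord_chartField_self {x : M} (w : E) :
    chartCoord I x x (chartField I x w x) = w :=
  (chartCoord_chartField (I := I) (x := x)).self_of_nhds w

theorem contMDiffAt_chartField (x : M) (w : E) : CMDiffAt ∞ (T% (chartField I x w)) x := by
  refine (contMDiffAt_extend I E (chartField I x w x)).congr_of_eventuallyEq ?_
  filter_upwards [extend_eventuallyEq_chartField (chartField I x w x)] with y hy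
  rw [hy, chartCoord_chartField_self]

theorem chartCoord_eventuallyEq (x : M) : ∀ᶠ y in 𝓝 x, ∀ v : TangentSpace I y,
    chartCoord I x y v = (trivializationAt E (fun x : M ↦ TangentSpace I x) x ⟨y, v⟩).2 := by
  let t := trivializationAt E (fun x : M ↦ TangentSpace I x) x
  filter_upwards [t.open_baseSet.mem_nhds (mem_baseSet_trivializationAt' x)] with y hy v
  change t.linearMapAt ℝ y v = (t ⟨y, v⟩).2
  rw [t.coe_linearMapAt_of_mem hy]

theorem mdiffAt_chartCoord {X : Π x : M, TangentSpace I x} {x : M} (hX : MDiffAt (T% X) x) :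
    MDiffAt (fun y ↦ chartCoord I x y (X y)) x := by
  refine ((mdifferentiableAt_section I X).1 hX).congr_of_eventuallyEq ?_
  filter_upwards [chartCoord_eventuallyEq (I := I) x] with y hy
  exact hy _

theorem contMDiffAt_chartCoord {X : Π x : M, TangentSpace I x} {x : M}
    (hX : CMDiffAt ∞ (T% X) x) : CMDiffAt ∞ (fun y ↦ chartCoord I x y (X y)) x := by
  refine ((contMDiffAt_section (s := X) (x₀ := x)).1 hX).congr_of_eventuallyEq ?_
  filter_upwards [chartCoord_eventuallyEq (I := I) x] with y hy
  exact hy _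

theorem chartField_sum {ι : Type*} (s : Finset ι) (x y : M) (c : ι → ℝ) (w : ι → E) :
    chartField I x (∑ i ∈ s, c i • w i) y = ∑ i ∈ s, c i • chartField I x (w i) y := by
  simp [chartField, map_sum]

variable (I) in
/-- The coordinate frame of the preferred chart at `x`. -/
def chartFrame (x : M) (i : Fin (Module.finrank ℝ E)) : Π y : M, TangentSpace I y :=
  chartField I x (Module.finBasis ℝ E i)

variable (I) in
/-- The coefficients with respect to `chartFrame`. -/
def chartComp (x : M) (i : Fin (Module.finrank ℝ E)) (y : M) : TangentSpace I y →L[ℝ] ℝ :=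
  ((ContinuousLinearMap.proj (R := ℝ) (φ := fun _ ↦ ℝ) i).comp
    ((Module.finBasis ℝ E).equivFunL : E →L[ℝ] (Fin (Module.finrank ℝ E) → ℝ))).comp
      (chartCoord I x y)

theorem contMDiffAt_chartFrame (x : M) (i : Fin (Module.finrank ℝ E)) :
    CMDiffAt ∞ (T% (chartFrame I x i)) x :=
  contMDiffAt_chartField x _

theorem eventually_eq_sum_chartFrame (x : M) : ∀ᶠ y in 𝓝 x, ∀ v : TangentSpace I y,
    v = ∑ i, chartComp I x i y v • chartFrame I x i y := by
  filter_upwards [chartField_chartCoord (I := I) (x := x)] with y hy v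
  have hsum (w : E) : ∑ i, (Module.finBasis ℝ E).equivFunL w i • Module.finBasis ℝ E i = w :=
    (Module.finBasis ℝ E).sum_equivFun w
  conv_lhs => rw [← hy v, ← hsum (chartCoord I x y v), chartField_sum]
  rfl

theorem contMDiffAt_chartComp {X : Π x : M, TangentSpace I x} {x : M}
    (hX : CMDiffAt ∞ (T% X) x) (i : Fin (Module.finrank ℝ E)) :
    CMDiffAt ∞ (fun y ↦ chartComp I x i y (X y)) x := by
  let p : E →L[ℝ] ℝ := (ContinuousLinearMap.proj (R := ℝ) (φ := fun _ ↦ ℝ) i).comp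
    ((Module.finBasis ℝ E).equivFunL : E →L[ℝ] (Fin (Module.finrank ℝ E) → ℝ))
  exact p.contMDiff.contMDiffAt.comp x (contMDiffAt_chartCoord hX)

end Frames

section ChartFormula

variable {E : Type*} [NormedAddCommGroup E] [NormedSpace ℝ E] [FiniteDimensional ℝ E]
  {H : Type*} [TopologicalSpace H] {I : ModelWithCorners ℝ E H}
  {M : Type*} [TopologicalSpace M] [ChartedSpace H M] [IsManifold I ∞ M]
  [RiemannianBundle (fun x : M ↦ TangentSpace I x)]
  [IsContMDiffRiemannianBundle I ∞ E (fun x : M ↦ TangentSpace I x)]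

theorem leviCivita_chartField_sum {ι : Type*} (s : Finset ι) (x : M) (c : ι → ℝ) (w : ι → E)
    (u : TangentSpace I x) :
    leviCivita I M (chartField I x (∑ i ∈ s, c i • w i)) x u
      = ∑ i ∈ s, c i • leviCivita I M (chartField I x (w i)) x u := by
  have e : chartField I x (∑ i ∈ s, c i • w i)
      = fun y ↦ ∑ i ∈ s, (fun _ : M ↦ c i) y • chartField I x (w i) y := by
    funext y
    exact chartField_sum s x y c w
  rw [e, leviCivita_sum_smul s (fun i _ ↦ mdifferentiableAt_const)
    (fun i _ ↦ mdiffAt_of_smooth (contMDiffAt_chartField x (w i)))]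
  simp [mvfderiv_const]

/-- The Levi-Civita derivative in the preferred chart: derivative of the components plus the
derivative of the field with frozen components. -/
theorem leviCivita_eq_chart {X : Π x : M, TangentSpace I x} {x : M} (hX : MDiffAt (T% X) x)
    (u : TangentSpace I x) :
    leviCivita I M X x u = chartField I x (mvfderiv I (fun y ↦ chartCoord I x y (X y)) x u) x
      + leviCivita I M (chartField I x (chartCoord I x x (X x))) x u := by
  let b := Module.finBasis ℝ E
  let c (i) (y : M) : ℝ := b.equivFunL (chartCoord I x y (X y)) i
  have hφ := mdiffAt_chartCoord hX
  let p (i) : E →L[ℝ] ℝ :=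
    (ContinuousLinearMap.proj (R := ℝ) (φ := fun _ ↦ ℝ) i).comp (b.equivFunL : E →L[ℝ] (Fin (Module.finrank ℝ E) → ℝ))
  have hpm (i) : MDifferentiableAt 𝓘(ℝ, E) 𝓘(ℝ, ℝ) (p i) (chartCoord I x x (X x)) :=
    (p i).differentiableAt.mdifferentiableAt
  have hc (i) : MDiffAt (c i) x := (hpm i).comp x hφ
  have hdc (i) : mvfderiv I (c i) x u
      = b.equivFunL (mvfderiv I (fun y ↦ chartCoord I x y (X y)) x u) i := by
    have := mvfderiv_comp_apply (f := fun y ↦ chartCoord I x y (X y)) (g := p i) x (hpm i) hφ u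
    refine this.trans ?_
    rw [mvfderiv, mfderiv_eq_fderiv, (p i).fderiv]
    rfl
  have hsum (w : E) : ∑ i, b.equivFunL w i • b i = w := b.sum_equivFun w
  have hev : ∀ᶠ y in 𝓝 x, X y = ∑ i, c i y • chartField I x (b i) y := by
    filter_upwards [chartField_chartCoord (I := I) (x := x)] with y hy
    rw [← chartField_sum, hsum, hy]
  rw [leviCivita_congr hX hev, leviCivita_sum_smul _ (fun i _ ↦ hc i)
    (fun i _ ↦ mdiffAt_of_smooth (contMDiffAt_chartField x (b i))), Finset.sum_add_distrib,
    add_comm]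
  simp_rw [hdc]
  rw [← chartField_sum, hsum, ← leviCivita_chartField_sum, hsum]

end ChartFormula

section AlongCurves

variable {E : Type*} [NormedAddCommGroup E] [NormedSpace ℝ E] [FiniteDimensional ℝ E]
  {H : Type*} [TopologicalSpace H] {I : ModelWithCorners ℝ E H}
  {M : Type*} [TopologicalSpace M] [ChartedSpace H M] [IsManifold I ∞ M]

theorem hasDerivWithinAt_comp_curve {F : Type*} [NormedAddCommGroup F] [NormedSpace ℝ F]
    {J : Set ℝ} {q : ℝ → M} {t : ℝ} {φ : M → F} (hφ : MDiffAt φ (q t))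
    (hq : MDifferentiableWithinAt 𝓘(ℝ, ℝ) I q J t) :
    HasDerivWithinAt (fun s ↦ φ (q s)) (mvfderiv I φ (q t) (velocity I J q t)) J t := by
  let L : ℝ →L[ℝ] F := (mfderiv I 𝓘(ℝ, F) φ (q t)).comp (mfderivWithin 𝓘(ℝ, ℝ) I q J t)
  have h : HasMFDerivWithinAt 𝓘(ℝ, ℝ) 𝓘(ℝ, F) (fun s ↦ φ (q s)) J t L :=
    hφ.hasMFDerivAt.comp_hasMFDerivWithinAt t hq.hasMFDerivWithinAt
  have h' : HasFDerivWithinAt (fun s ↦ φ (q s)) L J t :=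
    hasMFDerivWithinAt_iff_hasFDerivWithinAt.1 h
  exact h'.hasDerivWithinAt

variable [RiemannianBundle (fun x : M ↦ TangentSpace I x)]
  [IsContMDiffRiemannianBundle I ∞ E (fun x : M ↦ TangentSpace I x)]

/-- The covariant derivative along a curve of a time dependent combination of vector fields. -/
theorem covDerivAlong_sum {ι : Type*} [Fintype ι] {J : Set ℝ} {q : ℝ → M}
    {V : Π t : ℝ, TangentSpace I (q t)} {t : ℝ} {c : ι → ℝ → ℝ} {c' : ι → ℝ}
    {X : ι → Π x : M, TangentSpace I x}
    (hV : ∀ᶠ s in 𝓝[J] t, V s = ∑ i, c i s • X i (q s)) (ht : t ∈ J)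
    (hc : ∀ i, HasDerivWithinAt (c i) (c' i) J t) (hX : ∀ i, MDiffAt (T% (X i)) (q t))
    (hq : MDifferentiableWithinAt 𝓘(ℝ, ℝ) I q J t) (hJ : UniqueDiffWithinAt ℝ J t) :
    covDerivAlong I J q V t = ∑ i, c' i • X i (q t)
      + ∑ i, c i t • leviCivita I M (X i) (q t) (velocity I J q t) := by
  have hVt : V t = ∑ i, c i t • X i (q t) := hV.self_of_nhdsWithin ht
  have hd : HasDerivWithinAt (fun s ↦ chartCoord I (q t) (q s) (V s))
      (∑ i, (c i t • mvfderiv I (fun y ↦ chartCoord I (q t) y (X i y)) (q t) (velocity I J q t)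
        + c' i • chartCoord I (q t) (q t) (X i (q t)))) J t := by
    have h1 : HasDerivWithinAt (fun s ↦ ∑ i, c i s • chartCoord I (q t) (q s) (X i (q s)))
        (∑ i, (c i t • mvfderiv I (fun y ↦ chartCoord I (q t) y (X i y)) (q t) (velocity I J q t)
          + c' i • chartCoord I (q t) (q t) (X i (q t)))) J t := by
      refine HasDerivWithinAt.fun_sum fun i _ ↦ ?_
      exact (hc i).smul (hasDerivWithinAt_comp_curve (mdiffAt_chartCoord (hX i)) hq)
    refine h1.congr_of_eventuallyEq ?_ ?_
    · filter_upwards [hV] with s hs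
      rw [hs, map_sum]
      simp
    · rw [hVt, map_sum]
      simp
  have e : covDerivAlong I J q V t
      = chartField I (q t) (derivWithin (fun s ↦ chartCoord I (q t) (q s) (V s)) J t) (q t)
        + leviCivita I M (chartField I (q t) (chartCoord I (q t) (q t) (V t))) (q t)
          (velocity I J q t) := by
    rw [← leviCivita_congr (mdifferentiableAt_extend I E (V t))
      (extend_eventuallyEq_chartField (V t))]
    rfl
  rw [e, hd.derivWithin hJ, hVt, map_sum]
  simp_rw [map_smul]
  rw [leviCivita_chartField_sum]
  simp_rw [leviCivita_eq_chart (hX _)]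
  have e2 (w w' : E) : chartField I (q t) (w + w') (q t)
      = chartField I (q t) w (q t) + chartField I (q t) w' (q t) := by simp [chartField]
  rw [Finset.sum_add_distrib, e2, chartField_sum, chartField_sum]
  simp_rw [smul_add, Finset.sum_add_distrib, chartField_chartCoord_self]
  abel

end AlongCurves

section Commutator

variable {E : Type*} [NormedAddCommGroup E] [NormedSpace ℝ E] [FiniteDimensional ℝ E]
  {H : Type*} [TopologicalSpace H] {I : ModelWithCorners ℝ E H}
  {M : Type*} [TopologicalSpace M] [ChartedSpace H M] [IsManifold I ∞ M]

theorem mdiffAt_of_contMDiffAt {f : M → ℝ} {x : M} (hf : CMDiffAt ∞ f x) : MDiffAt f x :=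
  hf.mdifferentiableAt (by simp)

theorem eventually_mdiffAt_fun {f : M → ℝ} {x : M} (hf : CMDiffAt ∞ f x) :
    ∀ᶠ y in 𝓝 x, MDiffAt f y := by
  have h : CMDiffAt 1 f x := hf.of_le (by simp)
  exact ((contMDiffAt_iff_contMDiffAt_nhds (by simp)).1 h).mono
    fun y hy ↦ hy.mdifferentiableAt (by simp)

theorem mlieBracket_congr_right {X Y Y' : Π x : M, TangentSpace I x} {x : M}
    (h : ∀ᶠ y in 𝓝 x, Y y = Y' y) : mlieBracket I X Y x = mlieBracket I X Y' x :=
  Filter.EventuallyEq.mlieBracket_vectorField_eq (EventuallyEq.refl _ _) h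

/-- The Lie bracket acts on functions as the commutator. -/
theorem mvfderiv_mlieBracket {f : M → ℝ} {X Y : Π x : M, TangentSpace I x} {x : M}
    (hf : CMDiffAt ∞ f x) (hX : CMDiffAt ∞ (T% X) x) (hY : CMDiffAt ∞ (T% Y) x) :
    mvfderiv I f x (mlieBracket I X Y x)
      = mvfderiv I (fun y ↦ mvfderiv I f y (Y y)) x (X x)
        - mvfderiv I (fun y ↦ mvfderiv I f y (X y)) x (Y x) := by
  have := FiniteDimensional.complete ℝ E
  rcases subsingleton_or_nontrivial E with hE | hE
  · have h0 (v : TangentSpace I x) : v = 0 := Subsingleton.elim (α := E) _ _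
    rw [h0 (mlieBracket I X Y x), h0 (X x), h0 (Y x)]
    simp
  obtain ⟨w, hw⟩ := exists_ne (0 : E)
  let Z := chartField I x w
  have hZ : CMDiffAt ∞ (T% Z) x := contMDiffAt_chartField x w
  have hZx : Z x ≠ 0 := fun h ↦ hw (by
    rw [← chartCoord_chartField_self (I := I) (x := x) w]
    change chartCoord I x x (Z x) = 0
    rw [h, map_zero])
  have : IsManifold I (minSmoothness ℝ 3) M := .of_le (n := ∞) (by simpa using ENat.LEInfty.out)
  have key : ∀ U V : Π x : M, TangentSpace I x, CMDiffAt ∞ (T% U) x → CMDiffAt ∞ (T% V) x →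
      mlieBracket I U (mlieBracket I V (f • Z)) x
        = mvfderiv I (fun y ↦ mvfderiv I f y (V y)) x (U x) • Z x
          + mvfderiv I f x (V x) • mlieBracket I U Z x
          + mvfderiv I f x (U x) • mlieBracket I V Z x
          + f x • mlieBracket I U (mlieBracket I V Z) x := by
    intro U V hU hV
    have e : ∀ᶠ y in 𝓝 x, mlieBracket I V (f • Z) y
        = ((fun y ↦ mvfderiv I f y (V y)) • Z + f • mlieBracket I V Z) y := by
      filter_upwards [eventually_mdiffAt_fun hf, eventually_mdiffAt hZ] with y h1 h2
      rw [mlieBracket_smul_right h1 h2]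
      rfl
    have hVf := contMDiffAt_mvfderiv_apply hf hV
    have hVZ := contMDiffAt_mlieBracket hV hZ
    rw [mlieBracket_congr_right e, mlieBracket_add_right
      (mdiffAt_of_smooth (hVf.smul_section hZ)) (mdiffAt_of_smooth (hf.smul_section hVZ)),
      mlieBracket_smul_right (mdiffAt_of_contMDiffAt hVf) (mdiffAt_of_smooth hZ),
      mlieBracket_smul_right (mdiffAt_of_contMDiffAt hf) (mdiffAt_of_smooth hVZ)]
    abel
  have hle : minSmoothness ℝ 2 ≤ ∞ := by simpa using ENat.LEInfty.out
  have hfZ : CMDiffAt ∞ (T% (f • Z)) x := hf.smul_section hZ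
  have jac := leibniz_identity_mlieBracket_apply (hX.of_le hle) (hY.of_le hle) (hfZ.of_le hle)
  have jac' := leibniz_identity_mlieBracket_apply (hX.of_le hle) (hY.of_le hle) (hZ.of_le hle)
  rw [key X Y hX hY, key Y X hY hX,
    mlieBracket_smul_right (mdiffAt_of_contMDiffAt hf) (mdiffAt_of_smooth hZ), jac'] at jac
  have : (mvfderiv I f x (mlieBracket I X Y x)
      - (mvfderiv I (fun y ↦ mvfderiv I f y (Y y)) x (X x)
        - mvfderiv I (fun y ↦ mvfderiv I f y (X y)) x (Y x))) • Z x = 0 := by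
    rw [← neg_eq_zero, ← sub_eq_zero.2 jac]
    module
  exact sub_eq_zero.1 ((smul_eq_zero.1 this).resolve_right hZx)

end Commutator

section Curvature

variable {E : Type*} [NormedAddCommGroup E] [NormedSpace ℝ E] [FiniteDimensional ℝ E]
  {H : Type*} [TopologicalSpace H] {I : ModelWithCorners ℝ E H}
  {M : Type*} [TopologicalSpace M] [ChartedSpace H M] [IsManifold I ∞ M]
  [RiemannianBundle (fun x : M ↦ TangentSpace I x)]
  [IsContMDiffRiemannianBundle I ∞ E (fun x : M ↦ TangentSpace I x)]

/-- The curvature expression of three vector fields. -/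
def curvatureField (X Y Z : Π x : M, TangentSpace I x) (x : M) : TangentSpace I x :=
  leviCivita I M (fun y ↦ leviCivita I M Z y (Y y)) x (X x)
    - leviCivita I M (fun y ↦ leviCivita I M Z y (X y)) x (Y x)
    - leviCivita I M Z x (mlieBracket I X Y x)

theorem curvatureField_swap (X Y Z : Π x : M, TangentSpace I x) (x : M) :
    curvatureField X Y Z x = - curvatureField Y X Z x := by
  simp only [curvatureField]
  rw [mlieBracket_swap_apply, map_neg]
  abel

theorem leviCivita_leviCivita_add_bracket {X Y Z : Π x : M, TangentSpace I x} {x : M}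
    (hX : CMDiffAt ∞ (T% X) x) (hY : CMDiffAt ∞ (T% Y) x) (hZ : CMDiffAt ∞ (T% Z) x) :
    leviCivita I M (fun y ↦ leviCivita I M Z y (X y)) x (Y x)
        + leviCivita I M Z x (mlieBracket I X Y x)
      = ∑ i, chartComp I x i x (X x) •
          (leviCivita I M (fun y ↦ leviCivita I M Z y (chartFrame I x i y)) x (Y x)
            - leviCivita I M Z x (leviCivita I M (chartFrame I x i) x (Y x)))
        + leviCivita I M Z x (leviCivita I M Y x (X x)) := by
  have hc (i) := contMDiffAt_chartComp hX i
  have he (i) := contMDiffAt_chartFrame (I := I) x i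
  have hev : ∀ᶠ y in 𝓝 x, X y = ∑ i, chartComp I x i y (X y) • chartFrame I x i y := by
    filter_upwards [eventually_eq_sum_chartFrame (I := I) x] with y hy using hy _
  have hev' : ∀ᶠ y in 𝓝 x, leviCivita I M Z y (X y)
      = ∑ i, chartComp I x i y (X y) • leviCivita I M Z y (chartFrame I x i y) := by
    filter_upwards [hev] with y hy
    conv_lhs => rw [hy, map_sum]
    simp_rw [map_smul]
  rw [leviCivita_congr (mdiffAt_of_smooth (contMDiffAt_leviCivita hX hZ)) hev',
    leviCivita_sum_smul _ (fun i _ ↦ mdiffAt_of_contMDiffAt (hc i))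
      (fun i _ ↦ mdiffAt_of_smooth (contMDiffAt_leviCivita (he i) hZ)),
    ← leviCivita_sub_leviCivita (mdiffAt_of_smooth hX) (mdiffAt_of_smooth hY),
    leviCivita_congr (mdiffAt_of_smooth hX) hev,
    leviCivita_sum_smul _ (fun i _ ↦ mdiffAt_of_contMDiffAt (hc i))
      (fun i _ ↦ mdiffAt_of_smooth (he i)), map_sub, map_sum]
  simp_rw [map_add, map_smul, smul_sub, Finset.sum_add_distrib, Finset.sum_sub_distrib]
  abel

theorem curvatureField_congr_left {X X' Y Z : Π x : M, TangentSpace I x} {x : M}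
    (hX : CMDiffAt ∞ (T% X) x) (hX' : CMDiffAt ∞ (T% X') x) (hY : CMDiffAt ∞ (T% Y) x)
    (hZ : CMDiffAt ∞ (T% Z) x) (h : X x = X' x) :
    curvatureField X Y Z x = curvatureField X' Y Z x := by
  simp only [curvatureField]
  rw [sub_sub, sub_sub, leviCivita_leviCivita_add_bracket hX hY hZ,
    leviCivita_leviCivita_add_bracket hX' hY hZ, h]

theorem curvatureField_eq_sum {X Y Z : Π x : M, TangentSpace I x} {x : M}
    (hX : CMDiffAt ∞ (T% X) x) (hY : CMDiffAt ∞ (T% Y) x) (hZ : CMDiffAt ∞ (T% Z) x) :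
    curvatureField X Y Z x
      = ∑ i, chartComp I x i x (Z x) • curvatureField X Y (chartFrame I x i) x := by
  have hc (i) := contMDiffAt_chartComp hZ i
  have he (i) := contMDiffAt_chartFrame (I := I) x i
  have hev : ∀ᶠ y in 𝓝 x, Z y = ∑ i, chartComp I x i y (Z y) • chartFrame I x i y := by
    filter_upwards [eventually_eq_sum_chartFrame (I := I) x] with y hy using hy _
  have key : ∀ U V : Π x : M, TangentSpace I x, CMDiffAt ∞ (T% U) x → CMDiffAt ∞ (T% V) x →
      leviCivita I M (fun y ↦ leviCivita I M Z y (V y)) x (U x) = ∑ i,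
        (chartComp I x i x (Z x) •
            leviCivita I M (fun y ↦ leviCivita I M (chartFrame I x i) y (V y)) x (U x)
          + mvfderiv I (fun y ↦ chartComp I x i y (Z y)) x (U x) •
            leviCivita I M (chartFrame I x i) x (V x)
          + (mvfderiv I (fun y ↦ chartComp I x i y (Z y)) x (V x) •
            leviCivita I M (chartFrame I x i) x (U x)
          + mvfderiv I (fun y ↦ mvfderiv I (fun z ↦ chartComp I x i z (Z z)) y (V y)) x (U x) •
            chartFrame I x i x)) := by
    intro U V hU hV
    have hev' : ∀ᶠ y in 𝓝 x, leviCivita I M Z y (V y)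
        = ((fun y ↦ ∑ i, chartComp I x i y (Z y) • leviCivita I M (chartFrame I x i) y (V y))
          + fun y ↦ ∑ i, mvfderiv I (fun z ↦ chartComp I x i z (Z z)) y (V y) •
              chartFrame I x i y : Π y : M, TangentSpace I y) y := by
      filter_upwards [hev.eventually_nhds, eventually_mdiffAt hZ,
        eventually_all.2 fun i ↦ eventually_mdiffAt_fun (hc i),
        eventually_all.2 fun i ↦ eventually_mdiffAt (he i)] with y hy h1 h2 h3
      rw [leviCivita_congr h1 hy, leviCivita_sum_smul _ (fun i _ ↦ h2 i) (fun i _ ↦ h3 i),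
        Finset.sum_add_distrib]
      rfl
    have h1 (i) := contMDiffAt_leviCivita hV (he i)
    have h2 (i) := contMDiffAt_mvfderiv_apply (hc i) hV
    have h3 : MDiffAt (T% (fun y ↦ (∑ i, chartComp I x i y (Z y) •
        leviCivita I M (chartFrame I x i) y (V y) : TangentSpace I y))) x :=
      mdiffAt_of_smooth (ContMDiffAt.sum_section fun i _ ↦ (hc i).smul_section (h1 i))
    have h4 : MDiffAt (T% (fun y ↦ (∑ i, mvfderiv I (fun z ↦ chartComp I x i z (Z z)) y (V y) •
        chartFrame I x i y : TangentSpace I y))) x :=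
      mdiffAt_of_smooth (ContMDiffAt.sum_section fun i _ ↦ (h2 i).smul_section (he i))
    rw [leviCivita_congr (mdiffAt_of_smooth (contMDiffAt_leviCivita hV hZ)) hev',
      leviCivita_add h3 h4, add_apply,
      leviCivita_sum_smul _ (fun i _ ↦ mdiffAt_of_contMDiffAt (hc i))
        (fun i _ ↦ mdiffAt_of_smooth (h1 i)),
      leviCivita_sum_smul _ (fun i _ ↦ mdiffAt_of_contMDiffAt (h2 i))
        (fun i _ ↦ mdiffAt_of_smooth (he i)), ← Finset.sum_add_distrib]
  simp only [curvatureField]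
  rw [key X Y hX hY, key Y X hY hX, leviCivita_congr (mdiffAt_of_smooth hZ) hev,
    leviCivita_sum_smul _ (fun i _ ↦ mdiffAt_of_contMDiffAt (hc i))
      (fun i _ ↦ mdiffAt_of_smooth (he i)), ← Finset.sum_sub_distrib, ← Finset.sum_sub_distrib]
  refine Finset.sum_congr rfl fun i _ ↦ ?_
  rw [mvfderiv_mlieBracket (hc i) hX hY]
  module

/-- The curvature tensor may be computed with any smooth extensions. -/
theorem curvature_eq_curvatureField {X Y Z : Π x : M, TangentSpace I x} {x : M}
    (hX : CMDiffAt ∞ (T% X) x) (hY : CMDiffAt ∞ (T% Y) x) (hZ : CMDiffAt ∞ (T% Z) x) :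
    curvature I x (X x) (Y x) (Z x) = curvatureField X Y Z x := by
  have hX' := contMDiffAt_extend (k := ∞) I E (X x)
  have hY' := contMDiffAt_extend (k := ∞) I E (Y x)
  have hZ' := contMDiffAt_extend (k := ∞) I E (Z x)
  calc curvature I x (X x) (Y x) (Z x)
      = curvatureField (extend E (X x)) (extend E (Y x)) (extend E (Z x)) x := rfl
    _ = curvatureField X (extend E (Y x)) (extend E (Z x)) x :=
        curvatureField_congr_left hX' hX hY' hZ' (extend_apply_self ..)
    _ = curvatureField X Y (extend E (Z x)) x := by
        rw [curvatureField_swap, curvatureField_congr_left hY' hY hX hZ' (extend_apply_self ..),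
          ← curvatureField_swap]
    _ = curvatureField X Y Z x := by
        rw [curvatureField_eq_sum hX hY hZ', curvatureField_eq_sum hX hY hZ, extend_apply_self]

end Curvature

section Related

variable {E : Type*} [NormedAddCommGroup E] [NormedSpace ℝ E] [FiniteDimensional ℝ E]
  {H : Type*} [TopologicalSpace H] {I : ModelWithCorners ℝ E H}
  {M : Type*} [TopologicalSpace M] [ChartedSpace H M] [IsManifold I ∞ M]
  {E' : Type*} [NormedAddCommGroup E'] [NormedSpace ℝ E'] [FiniteDimensional ℝ E']
  {H' : Type*} [TopologicalSpace H'] {I' : ModelWithCorners ℝ E' H'}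
  {N : Type*} [TopologicalSpace N] [ChartedSpace H' N] [IsManifold I' ∞ N]

/-- Tangent vectors are separated by the differentials of smooth functions. -/
theorem eq_of_mvfderiv_eq {x : M} {u v : TangentSpace I x}
    (h : ∀ f : M → ℝ, CMDiffAt ∞ f x → mvfderiv I f x u = mvfderiv I f x v) : u = v := by
  have hinv : (mfderiv I 𝓘(ℝ, E) (extChartAt I x) x).IsInvertible :=
    isInvertible_mfderiv_extChartAt (mem_extChartAt_source x)
  refine hinv.injective ?_
  let b := Module.finBasis ℝ E
  refine b.ext_elem (x := (mfderiv I 𝓘(ℝ, E) (extChartAt I x) x u : E)) fun i ↦ ?_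
  let p : E →L[ℝ] ℝ := (ContinuousLinearMap.proj (R := ℝ) (φ := fun _ ↦ ℝ) i).comp
    (b.equivFunL : E →L[ℝ] (Fin (Module.finrank ℝ E) → ℝ))
  have hc : ContMDiffAt I 𝓘(ℝ, E) ∞ (extChartAt I x) x := contMDiffAt_extChartAt
  have hp : MDifferentiableAt 𝓘(ℝ, E) 𝓘(ℝ, ℝ) p (extChartAt I x x) :=
    p.differentiableAt.mdifferentiableAt
  have hd (w : TangentSpace I x) : mvfderiv I (fun y ↦ p (extChartAt I x y)) x w
      = b.repr (mfderiv I 𝓘(ℝ, E) (extChartAt I x) x w : E) i := by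
    refine (mvfderiv_comp_apply (f := extChartAt I x) (g := p) x hp
      (hc.mdifferentiableAt (by simp)) w).trans ?_
    rw [mvfderiv, mfderiv_eq_fderiv, p.fderiv]
    rfl
  rw [← hd, ← hd]
  exact h _ (p.contMDiff.contMDiffAt.comp x hc)

theorem mvfderiv_congr {f g : M → ℝ} {x : M} (h : f =ᶠ[𝓝 x] g) :
    mvfderiv I f x = mvfderiv I g x := by
  have h' := h.mfderiv_eq (I := I) (I' := 𝓘(ℝ, ℝ))
  ext u
  exact congrArg (fun L : E →L[ℝ] ℝ ↦ L u) h'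

theorem mvfderiv_comp_map {p : M → N} {f : N → ℝ} {x : M} (hf : MDiffAt f (p x))
    (hp : MDifferentiableAt I I' p x) (u : TangentSpace I x) :
    mvfderiv I (fun z ↦ f (p z)) x u = mvfderiv I' f (p x) (mfderiv I I' p x u) :=
  mvfderiv_comp_apply (f := p) (g := f) x hf hp u

/-- The bracket of `p`-related vector fields is `p`-related to the bracket. -/
theorem mfderiv_mlieBracket {p : M → N} {x : M} (hp : CMDiffAt ∞ p x)
    {X Y : Π x : M, TangentSpace I x} {X' Y' : Π y : N, TangentSpace I' y}
    (hX : CMDiffAt ∞ (T% X) x) (hY : CMDiffAt ∞ (T% Y) x)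
    (hX' : CMDiffAt ∞ (T% X') (p x)) (hY' : CMDiffAt ∞ (T% Y') (p x))
    (hXX' : ∀ᶠ z in 𝓝 x, mfderiv I I' p z (X z) = X' (p z))
    (hYY' : ∀ᶠ z in 𝓝 x, mfderiv I I' p z (Y z) = Y' (p z)) :
    mfderiv I I' p x (mlieBracket I X Y x) = mlieBracket I' X' Y' (p x) := by
  have hpm : MDifferentiableAt I I' p x := hp.mdifferentiableAt (by simp)
  refine eq_of_mvfderiv_eq fun f hf ↦ ?_
  have key : ∀ (U V : Π x : M, TangentSpace I x) (U' V' : Π y : N, TangentSpace I' y),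
      CMDiffAt ∞ (T% V') (p x) →
      (∀ᶠ z in 𝓝 x, mfderiv I I' p z (U z) = U' (p z)) →
      (∀ᶠ z in 𝓝 x, mfderiv I I' p z (V z) = V' (p z)) →
      mvfderiv I (fun z ↦ mvfderiv I (fun z ↦ f (p z)) z (V z)) x (U x)
        = mvfderiv I' (fun y ↦ mvfderiv I' f y (V' y)) (p x) (U' (p x)) := by
    intro U V U' V' hV' hU hV
    have e : (fun z ↦ mvfderiv I (fun z ↦ f (p z)) z (V z))
        =ᶠ[𝓝 x] fun z ↦ mvfderiv I' f (p z) (V' (p z)) := by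
      have h1 : CMDiffAt 1 p x := hp.of_le (by simp)
      filter_upwards [hV, hp.continuousAt.eventually (eventually_mdiffAt_fun hf),
        (contMDiffAt_iff_contMDiffAt_nhds (by simp)).1 h1] with z h1 h2 h3
      rw [mvfderiv_comp_map h2 (h3.mdifferentiableAt (by simp)), h1]
    have e' : mvfderiv I (fun z ↦ mvfderiv I (fun z ↦ f (p z)) z (V z)) x
        = mvfderiv I (fun z ↦ mvfderiv I' f (p z) (V' (p z))) x := mvfderiv_congr e
    rw [e', mvfderiv_comp_map (f := fun y ↦ mvfderiv I' f y (V' y))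
      (mdiffAt_of_contMDiffAt (contMDiffAt_mvfderiv_apply hf hV')) hpm, hU.self_of_nhds]
  rw [← mvfderiv_comp_map (mdiffAt_of_contMDiffAt hf) hpm,
    mvfderiv_mlieBracket (f := fun z ↦ f (p z)) (hf.comp x hp) hX hY,
    mvfderiv_mlieBracket hf hX' hY', key X Y X' Y' hY' hXX' hYY', key Y X Y' X' hX' hYY' hXX']

end Related

section HorizontalLift

variable {E : Type*} [NormedAddCommGroup E] [NormedSpace ℝ E] [FiniteDimensional ℝ E]
  {H : Type*} [TopologicalSpace H] {I : ModelWithCorners ℝ E H}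
  {M : Type*} [TopologicalSpace M] [ChartedSpace H M] [IsManifold I ∞ M]
  [RiemannianBundle (fun x : M ↦ TangentSpace I x)]
  {E' : Type*} [NormedAddCommGroup E'] [NormedSpace ℝ E'] [FiniteDimensional ℝ E']
  {H' : Type*} [TopologicalSpace H'] {I' : ModelWithCorners ℝ E' H'}
  {N : Type*} [TopologicalSpace N] [ChartedSpace H' N] [IsManifold I' ∞ N]
  [RiemannianBundle (fun x : N ↦ TangentSpace I' x)]

variable (I I') in
/-- The horizontal lift of tangent vectors, the adjoint of the differential of `p`. -/
def hlift (p : M → N) (x : M) : TangentSpace I' (p x) →ₗ[ℝ] TangentSpace I x :=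
  LinearMap.adjoint (mfderiv I I' p x).toLinearMap

variable {p : M → N}

theorem inner_hlift {x : M} (u : TangentSpace I' (p x)) (v : TangentSpace I x) :
    (inner ℝ (hlift I I' p x u) v : ℝ) = inner ℝ u (mfderiv I I' p x v) :=
  LinearMap.adjoint_inner_left _ _ _

theorem mem_verticalSpace {x : M} {v : TangentSpace I x} :
    v ∈ verticalSpace I I' p x ↔ mfderiv I I' p x v = 0 := Iff.rfl

theorem hlift_mem {x : M} (u : TangentSpace I' (p x)) :
    hlift I I' p x u ∈ horizontalSpace I I' p x := by
  refine (Submodule.mem_orthogonal' _ _).2 fun v hv ↦ ?_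
  rw [inner_hlift, mem_verticalSpace.1 hv, inner_zero_right]

variable (hp : IsRiemannianSubmersion I I' p)
include hp

theorem hlift_mfderiv {x : M} (v : TangentSpace I x) :
    hlift I I' p x (mfderiv I I' p x v) = (horizontalSpace I I' p x).starProjection v := by
  set K := verticalSpace I I' p x with hK
  have hh : Kᗮ = horizontalSpace I I' p x := rfl
  have hv : v - Kᗮ.starProjection v ∈ K := by
    have := Submodule.sub_starProjection_mem_orthogonal (K := Kᗮ) v
    rwa [Submodule.orthogonal_orthogonal] at this
  have hdp : mfderiv I I' p x v = mfderiv I I' p x (Kᗮ.starProjection v) := by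
    rw [← sub_eq_zero, ← map_sub]
    exact hv
  refine ext_inner_right ℝ fun w ↦ ?_
  have hw : w - Kᗮ.starProjection w ∈ K := by
    have := Submodule.sub_starProjection_mem_orthogonal (K := Kᗮ) w
    rwa [Submodule.orthogonal_orthogonal] at this
  have hdw : mfderiv I I' p x w = mfderiv I I' p x (Kᗮ.starProjection w) := by
    rw [← sub_eq_zero, ← map_sub]
    exact hw
  have h1 := hp.inner_eq x _ (Submodule.starProjection_apply_mem Kᗮ v) _
    (Submodule.starProjection_apply_mem Kᗮ w)
  rw [inner_hlift, hdp, hdw, ← h1, ← hh]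
  have h0 : (inner ℝ (Kᗮ.starProjection v) (w - Kᗮ.starProjection w) : ℝ) = 0 :=
    (Submodule.mem_orthogonal' _ _).1 (Submodule.starProjection_apply_mem Kᗮ v) _ hw
  rw [inner_sub_right, sub_eq_zero] at h0
  exact h0.symm

theorem mfderiv_hlift {x : M} (u : TangentSpace I' (p x)) :
    mfderiv I I' p x (hlift I I' p x u) = u := by
  obtain ⟨v, rfl⟩ := hp.mfderiv_surjective x u
  rw [hlift_mfderiv hp, ← sub_eq_zero, ← map_sub, ← neg_sub, map_neg, neg_eq_zero]
  have := Submodule.sub_starProjection_mem_orthogonal (K := horizontalSpace I I' p x) v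
  rw [horizontalSpace, Submodule.orthogonal_orthogonal] at this
  exact this

theorem hlift_mfderiv_of_mem {x : M} {v : TangentSpace I x} (hv : v ∈ horizontalSpace I I' p x) :
    hlift I I' p x (mfderiv I I' p x v) = v := by
  rw [hlift_mfderiv hp, Submodule.starProjection_eq_self_iff.2 hv]

theorem inner_hlift_hlift {x : M} (u v : TangentSpace I' (p x)) :
    (inner ℝ (hlift I I' p x u) (hlift I I' p x v) : ℝ) = inner ℝ u v := by
  rw [inner_hlift, mfderiv_hlift hp]

theorem verticalProj_eq {x : M} (v : TangentSpace I x) :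
    (verticalSpace I I' p x).starProjection v = v - hlift I I' p x (mfderiv I I' p x v) := by
  rw [hlift_mfderiv hp, horizontalSpace, Submodule.starProjection_orthogonal_val, sub_sub_cancel]

end HorizontalLift

section LiftedFields

variable {E : Type*} [NormedAddCommGroup E] [NormedSpace ℝ E] [FiniteDimensional ℝ E]
  {H : Type*} [TopologicalSpace H] {I : ModelWithCorners ℝ E H}
  {M : Type*} [TopologicalSpace M] [ChartedSpace H M] [IsManifold I ∞ M]
  [RiemannianBundle (fun x : M ↦ TangentSpace I x)]
  [IsContMDiffRiemannianBundle I ∞ E (fun x : M ↦ TangentSpace I x)]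
  {E' : Type*} [NormedAddCommGroup E'] [NormedSpace ℝ E'] [FiniteDimensional ℝ E']
  {H' : Type*} [TopologicalSpace H'] {I' : ModelWithCorners ℝ E' H'}
  {N : Type*} [TopologicalSpace N] [ChartedSpace H' N] [IsManifold I' ∞ N]
  [RiemannianBundle (fun x : N ↦ TangentSpace I' x)]
  [IsContMDiffRiemannianBundle I' ∞ E' (fun x : N ↦ TangentSpace I' x)]
  {p : M → N}

variable (I I') in
/-- The horizontal lift of a vector field. -/
def liftField (p : M → N) (X : Π y : N, TangentSpace I' y) (x : M) : TangentSpace I x :=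
  hlift I I' p x (X (p x))

variable (I I') in
/-- A vertical extension of a vertical tangent vector. -/
def verticalExtend (p : M → N) {x : M} (v : TangentSpace I x) (z : M) : TangentSpace I z :=
  extend E v z - hlift I I' p z (mfderiv I I' p z (extend E v z))

variable (hp : IsRiemannianSubmersion I I' p)
include hp

theorem contMDiffAt_hlift {v : Π z : M, TangentSpace I' (p z)} {x : M}
    (hv : ContMDiffAt I I'.tangent ∞ (fun z ↦ (⟨p z, v z⟩ : TangentBundle I' N)) x) :
    CMDiffAt ∞ (T% (fun z ↦ hlift I I' p z (v z))) x := by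
  refine contMDiffAt_of_inner fun Z hZ ↦ ?_
  simp_rw [inner_hlift]
  exact ContMDiffAt.inner_bundle (F := E') (E := fun y : N ↦ TangentSpace I' y) (IB := I')
    (b := p) hv (contMDiffAt_mfderiv_apply hp.contMDiff.contMDiffAt hZ)

theorem contMDiffAt_liftField {X : Π y : N, TangentSpace I' y} {x : M}
    (hX : CMDiffAt ∞ (T% X) (p x)) : CMDiffAt ∞ (T% (liftField I I' p X)) x :=
  contMDiffAt_hlift hp (hX.comp x hp.contMDiff.contMDiffAt)

theorem contMDiffAt_hlift_mfderiv {X : Π x : M, TangentSpace I x} {x : M}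
    (hX : CMDiffAt ∞ (T% X) x) :
    CMDiffAt ∞ (T% (fun z ↦ hlift I I' p z (mfderiv I I' p z (X z)))) x :=
  contMDiffAt_hlift hp (contMDiffAt_mfderiv_apply hp.contMDiff.contMDiffAt hX)

theorem contMDiffAt_verticalExtend {x : M} (v : TangentSpace I x) :
    CMDiffAt ∞ (T% (verticalExtend I I' p v)) x :=
  (contMDiffAt_extend I E v).sub_section
    (contMDiffAt_hlift_mfderiv hp (contMDiffAt_extend I E v))

theorem mfderiv_verticalExtend {x : M} (v : TangentSpace I x) (z : M) :
    mfderiv I I' p z (verticalExtend I I' p v z) = 0 := by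
  rw [verticalExtend, map_sub, mfderiv_hlift hp, sub_self]

theorem verticalExtend_self {x : M} {v : TangentSpace I x} (hv : mfderiv I I' p x v = 0) :
    verticalExtend I I' p v x = v := by
  rw [verticalExtend, extend_apply_self, hv, map_zero, sub_zero]

theorem mfderiv_liftField (X : Π y : N, TangentSpace I' y) (z : M) :
    mfderiv I I' p z (liftField I I' p X z) = X (p z) :=
  mfderiv_hlift hp _

theorem horizontalExtend_eq {x : M} (v : TangentSpace I x) :
    horizontalExtend I I' p v
      = fun z ↦ hlift I I' p z (mfderiv I I' p z (extend E v z)) := by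
  funext z
  exact (hlift_mfderiv hp _).symm

theorem contMDiffAt_horizontalExtend {x : M} (v : TangentSpace I x) :
    CMDiffAt ∞ (T% (horizontalExtend I I' p v)) x := by
  rw [horizontalExtend_eq hp]
  exact contMDiffAt_hlift_mfderiv hp (contMDiffAt_extend I E v)

theorem horizontalExtend_self {x : M} {v : TangentSpace I x}
    (hv : v ∈ horizontalSpace I I' p x) : horizontalExtend I I' p v x = v := by
  rw [horizontalExtend_eq hp]
  simp only [extend_apply_self]
  exact hlift_mfderiv_of_mem hp hv

omit hp in
theorem mvfderiv_eq_zero {f : M → ℝ} {x : M} (h : ∀ᶠ z in 𝓝 x, f z = 0) :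
    mvfderiv I f x = 0 :=
  (mvfderiv_congr (g := fun _ ↦ 0) h).trans (mvfderiv_const 0)

omit hp in
theorem inner_horizontal_vertical {x : M} {u v : TangentSpace I x}
    (hu : u ∈ horizontalSpace I I' p x) (hv : mfderiv I I' p x v = 0) :
    (inner ℝ u v : ℝ) = 0 :=
  (Submodule.mem_orthogonal' _ _).1 hu v hv

omit hp in
theorem inner_leviCivita_of_inner_eq_zero {Y V : Π x : M, TangentSpace I x} {x : M}
    (hY : MDiffAt (T% Y) x) (hV : MDiffAt (T% V) x)
    (h : ∀ᶠ z in 𝓝 x, (inner ℝ (Y z) (V z) : ℝ) = 0) (u : TangentSpace I x) :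
    (inner ℝ (leviCivita I M Y x u) (V x) : ℝ) = - inner ℝ (Y x) (leviCivita I M V x u) := by
  have h1 := leviCivita_metric hY hV u
  have h2 : mvfderiv I (fun y ↦ (inner ℝ (Y y) (V y) : ℝ)) x = 0 :=
    (mvfderiv_congr (g := fun _ ↦ (0 : ℝ)) h).trans (mvfderiv_const 0)
  rw [h2, zero_apply] at h1
  linarith

omit hp in
theorem inner_mlieBracket_of_horizontal {X Y V : Π x : M, TangentSpace I x} {x : M}
    (hX : MDiffAt (T% X) x) (hY : MDiffAt (T% Y) x) (hV : MDiffAt (T% V) x)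
    (hXh : ∀ᶠ z in 𝓝 x, X z ∈ horizontalSpace I I' p z)
    (hYh : ∀ᶠ z in 𝓝 x, Y z ∈ horizontalSpace I I' p z)
    (hVv : ∀ᶠ z in 𝓝 x, mfderiv I I' p z (V z) = 0) :
    (inner ℝ (mlieBracket I X Y x) (V x) : ℝ)
      = inner ℝ (X x) (leviCivita I M V x (Y x)) - inner ℝ (Y x) (leviCivita I M V x (X x)) := by
  rw [← leviCivita_sub_leviCivita hX hY, inner_sub_left, inner_leviCivita_of_inner_eq_zero hY hV,
    inner_leviCivita_of_inner_eq_zero hX hV]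
  · ring
  · filter_upwards [hXh, hVv] with z h1 h2 using inner_horizontal_vertical h1 h2
  · filter_upwards [hYh, hVv] with z h1 h2 using inner_horizontal_vertical h1 h2

theorem inner_verticalProj {x : M} (v : TangentSpace I x) {w : TangentSpace I x}
    (hw : mfderiv I I' p x w = 0) :
    (inner ℝ ((verticalSpace I I' p x).starProjection v) w : ℝ) = inner ℝ v w := by
  rw [verticalProj_eq hp, inner_sub_left, inner_hlift, hw, inner_zero_right, sub_zero]

theorem mfderiv_verticalProj {x : M} (v : TangentSpace I x) :
    mfderiv I I' p x ((verticalSpace I I' p x).starProjection v) = 0 := by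
  rw [verticalProj_eq hp, map_sub, mfderiv_hlift hp, sub_self]

omit hp in
theorem eq_of_inner_vertical {x : M} {u v : TangentSpace I x} (hu : mfderiv I I' p x u = 0)
    (hv : mfderiv I I' p x v = 0)
    (h : ∀ w, mfderiv I I' p x w = 0 → (inner ℝ u w : ℝ) = inner ℝ v w) : u = v := by
  rw [← sub_eq_zero, ← inner_self_eq_zero (𝕜 := ℝ), inner_sub_left, sub_eq_zero]
  exact h _ (by rw [map_sub, hu, hv, sub_self])

theorem inner_verticalBracket {x : M} {u v w : TangentSpace I x}
    (hu : u ∈ horizontalSpace I I' p x) (hv : v ∈ horizontalSpace I I' p x)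
    (hw : mfderiv I I' p x w = 0) :
    (inner ℝ (verticalBracket I I' p x u v) w : ℝ)
      = inner ℝ u (leviCivita I M (verticalExtend I I' p w) x v)
        - inner ℝ v (leviCivita I M (verticalExtend I I' p w) x u) := by
  have h := inner_mlieBracket_of_horizontal (p := p) (I' := I')
    (mdiffAt_of_smooth (contMDiffAt_horizontalExtend hp u))
    (mdiffAt_of_smooth (contMDiffAt_horizontalExtend hp v))
    (mdiffAt_of_smooth (contMDiffAt_verticalExtend hp w))
    (Eventually.of_forall fun z ↦ Submodule.starProjection_apply_mem _ _)
    (Eventually.of_forall fun z ↦ Submodule.starProjection_apply_mem _ _)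
    (Eventually.of_forall fun z ↦ mfderiv_verticalExtend hp w z)
  rw [horizontalExtend_self hp hu, horizontalExtend_self hp hv, verticalExtend_self hp hw] at h
  rw [← h, verticalBracket, inner_verticalProj hp _ hw]

/-- The vertical bracket may be computed with any smooth horizontal extensions. -/
theorem verticalBracket_eq {X Y : Π x : M, TangentSpace I x} {x : M}
    (hX : MDiffAt (T% X) x) (hY : MDiffAt (T% Y) x)
    (hXh : ∀ᶠ z in 𝓝 x, X z ∈ horizontalSpace I I' p z)
    (hYh : ∀ᶠ z in 𝓝 x, Y z ∈ horizontalSpace I I' p z) :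
    verticalBracket I I' p x (X x) (Y x)
      = (verticalSpace I I' p x).starProjection (mlieBracket I X Y x) := by
  refine eq_of_inner_vertical (mfderiv_verticalProj hp _) (mfderiv_verticalProj hp _) fun w hw ↦ ?_
  rw [inner_verticalBracket hp hXh.self_of_nhds hYh.self_of_nhds hw, inner_verticalProj hp _ hw]
  have h := inner_mlieBracket_of_horizontal hX hY
    (mdiffAt_of_smooth (contMDiffAt_verticalExtend hp w)) hXh hYh
    (Eventually.of_forall fun z ↦ mfderiv_verticalExtend hp w z)
  rw [verticalExtend_self hp hw] at h
  exact h.symm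

theorem mfderiv_verticalBracket {x : M} (u v : TangentSpace I x) :
    mfderiv I I' p x (verticalBracket I I' p x u v) = 0 :=
  mfderiv_verticalProj hp _

/-- O'Neill's tensor of a Riemannian submersion on horizontal vectors, `A_u v = [u, v]^V / 2`, as
a bilinear map on the tangent spaces of the base. -/
def oneill (x : M) :
    TangentSpace I' (p x) →ₗ[ℝ] TangentSpace I' (p x) →ₗ[ℝ] TangentSpace I x :=
  LinearMap.mk₂ ℝ
    (fun u v ↦ (2⁻¹ : ℝ) • verticalBracket I I' p x (hlift I I' p x u) (hlift I I' p x v))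
    (fun u u' v ↦ by
      rw [← smul_add]
      congr 1
      refine eq_of_inner_vertical (mfderiv_verticalBracket hp _ _)
        (by rw [map_add, mfderiv_verticalBracket hp, mfderiv_verticalBracket hp, add_zero])
        fun w hw ↦ ?_
      rw [inner_add_left]
      iterate 3 rw [inner_verticalBracket hp (hlift_mem _) (hlift_mem _) hw]
      simp only [map_add, inner_add_left, inner_add_right]
      ring)
    (fun c u v ↦ by
      rw [smul_comm]
      congr 1
      refine eq_of_inner_vertical (mfderiv_verticalBracket hp _ _)
        (by rw [map_smul, mfderiv_verticalBracket hp, smul_zero]) fun w hw ↦ ?_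
      rw [real_inner_smul_left]
      iterate 2 rw [inner_verticalBracket hp (hlift_mem _) (hlift_mem _) hw]
      simp only [map_smul, real_inner_smul_left, real_inner_smul_right]
      ring)
    (fun u v v' ↦ by
      rw [← smul_add]
      congr 1
      refine eq_of_inner_vertical (mfderiv_verticalBracket hp _ _)
        (by rw [map_add, mfderiv_verticalBracket hp, mfderiv_verticalBracket hp, add_zero])
        fun w hw ↦ ?_
      rw [inner_add_left]
      iterate 3 rw [inner_verticalBracket hp (hlift_mem _) (hlift_mem _) hw]
      simp only [map_add, inner_add_left, inner_add_right]
      ring)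
    (fun c u v ↦ by
      rw [smul_comm]
      congr 1
      refine eq_of_inner_vertical (mfderiv_verticalBracket hp _ _)
        (by rw [map_smul, mfderiv_verticalBracket hp, smul_zero]) fun w hw ↦ ?_
      rw [real_inner_smul_left]
      iterate 2 rw [inner_verticalBracket hp (hlift_mem _) (hlift_mem _) hw]
      simp only [map_smul, real_inner_smul_left, real_inner_smul_right]
      ring)

theorem oneill_apply (x : M) (u v : TangentSpace I' (p x)) :
    oneill hp x u v
      = (2⁻¹ : ℝ) • verticalBracket I I' p x (hlift I I' p x u) (hlift I I' p x v) := rfl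

theorem oneill_eq_zero_iff {x : M} {u v : TangentSpace I' (p x)} :
    oneill hp x u v = 0 ↔
      verticalBracket I I' p x (hlift I I' p x u) (hlift I I' p x v) = 0 := by
  rw [oneill_apply, smul_eq_zero_iff_right (by norm_num)]

theorem mfderiv_oneill {x : M} (u v : TangentSpace I' (p x)) :
    mfderiv I I' p x (oneill hp x u v) = 0 := by
  rw [oneill_apply, map_smul, mfderiv_verticalBracket hp, smul_zero]

theorem oneill_self {x : M} (u : TangentSpace I' (p x)) : oneill hp x u u = 0 := by
  rw [oneill_apply, verticalBracket, mlieBracket_self, Pi.zero_apply, map_zero, smul_zero]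

theorem oneill_swap {x : M} (u v : TangentSpace I' (p x)) :
    oneill hp x u v = - oneill hp x v u := by
  rw [oneill_apply, oneill_apply, verticalBracket, mlieBracket_swap_apply, map_neg, smul_neg]
  rfl

theorem mlieBracket_liftField {X Y : Π y : N, TangentSpace I' y} {x : M}
    (hX : CMDiffAt ∞ (T% X) (p x)) (hY : CMDiffAt ∞ (T% Y) (p x)) :
    mlieBracket I (liftField I I' p X) (liftField I I' p Y) x
      = hlift I I' p x (mlieBracket I' X Y (p x))
        + (2 : ℝ) • oneill hp x (X (p x)) (Y (p x)) := by
  have hX' := contMDiffAt_liftField hp hX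
  have hY' := contMDiffAt_liftField hp hY
  have h1 := mfderiv_mlieBracket hp.contMDiff.contMDiffAt hX' hY' hX hY
    (Eventually.of_forall fun z ↦ mfderiv_liftField hp X z)
    (Eventually.of_forall fun z ↦ mfderiv_liftField hp Y z)
  have h2 := verticalBracket_eq hp (mdiffAt_of_smooth hX') (mdiffAt_of_smooth hY')
    (Eventually.of_forall fun z ↦ hlift_mem _) (Eventually.of_forall fun z ↦ hlift_mem _)
  rw [verticalProj_eq hp, h1] at h2
  rw [oneill_apply, smul_smul, mul_inv_cancel₀ (by norm_num), one_smul]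
  exact (add_sub_cancel _ _).symm.trans (by rw [← h2]; rfl)

/-- The bracket of a lifted field with a vertical field is vertical. -/
theorem mfderiv_mlieBracket_vertical {X : Π y : N, TangentSpace I' y} {V : Π x : M, TangentSpace I x}
    {x : M} (hX : CMDiffAt ∞ (T% X) (p x)) (hV : CMDiffAt ∞ (T% V) x)
    (hVv : ∀ᶠ z in 𝓝 x, mfderiv I I' p z (V z) = 0) :
    mfderiv I I' p x (mlieBracket I (liftField I I' p X) V x) = 0 := by
  have h0 : CMDiffAt ∞ (T% (0 : Π y : N, TangentSpace I' y)) (p x) :=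
    (contMDiff_zeroSection ℝ (fun y : N ↦ TangentSpace I' y)).contMDiffAt
  rw [mfderiv_mlieBracket hp.contMDiff.contMDiffAt (contMDiffAt_liftField hp hX) hV hX h0
    (Eventually.of_forall fun z ↦ mfderiv_liftField hp X z) hVv]
  simp

theorem mvfderiv_inner_liftField {X Y : Π y : N, TangentSpace I' y} {x : M}
    (hX : CMDiffAt ∞ (T% X) (p x)) (hY : CMDiffAt ∞ (T% Y) (p x)) (u : TangentSpace I x) :
    mvfderiv I (fun z ↦ (inner ℝ (liftField I I' p X z) (liftField I I' p Y z) : ℝ)) x u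
      = mvfderiv I' (fun y ↦ (inner ℝ (X y) (Y y) : ℝ)) (p x) (mfderiv I I' p x u) := by
  rw [← mvfderiv_comp_map (f := fun y ↦ (inner ℝ (X y) (Y y) : ℝ))
    (mdiffAt_of_contMDiffAt (contMDiffAt_inner hX hY))
    (hp.contMDiff.contMDiffAt.mdifferentiableAt (by simp))]
  congr 2
  funext z
  exact inner_hlift_hlift hp _ _

theorem koszul_liftField {X Y Z : Π y : N, TangentSpace I' y} {x : M}
    (hX : CMDiffAt ∞ (T% X) (p x)) (hY : CMDiffAt ∞ (T% Y) (p x)) (hZ : CMDiffAt ∞ (T% Z) (p x)) :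
    koszul (liftField I I' p X) (liftField I I' p Y) (liftField I I' p Z) x
      = koszul X Y Z (p x) := by
  have hb : ∀ U V W : Π y : N, TangentSpace I' y, CMDiffAt ∞ (T% U) (p x) →
      CMDiffAt ∞ (T% V) (p x) →
      (inner ℝ (mlieBracket I (liftField I I' p U) (liftField I I' p V) x) (liftField I I' p W x) : ℝ)
        = inner ℝ (mlieBracket I' U V (p x)) (W (p x)) := by
    intro U V W hU hV
    rw [real_inner_comm, liftField, inner_hlift, mlieBracket_liftField hp hU hV, map_add,
      mfderiv_hlift hp, map_smul, mfderiv_oneill hp, smul_zero, add_zero, real_inner_comm]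
  simp only [koszul]
  rw [hb X Y Z hX hY, hb X Z Y hX hZ, hb Y Z X hY hZ, mvfderiv_inner_liftField hp hY hZ,
    mvfderiv_inner_liftField hp hX hZ, mvfderiv_inner_liftField hp hX hY]
  simp only [mfderiv_liftField hp]

theorem leviCivita_liftField {X Y : Π y : N, TangentSpace I' y} {x : M}
    (hX : CMDiffAt ∞ (T% X) (p x)) (hY : CMDiffAt ∞ (T% Y) (p x)) :
    leviCivita I M (liftField I I' p Y) x (liftField I I' p X x)
      = hlift I I' p x (leviCivita I' N Y (p x) (X (p x))) + oneill hp x (X (p x)) (Y (p x)) := by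
  have hX' := contMDiffAt_liftField hp hX
  have hY' := contMDiffAt_liftField hp hY
  refine ext_inner_right ℝ fun w ↦ ?_
  have hw : mfderiv I I' p x (w - hlift I I' p x (mfderiv I I' p x w)) = 0 := by
    rw [map_sub, mfderiv_hlift hp, sub_self]
  rw [← sub_add_cancel w (hlift I I' p x (mfderiv I I' p x w))]
  generalize w - hlift I I' p x (mfderiv I I' p x w) = ν at hw
  generalize mfderiv I I' p x w = z
  rw [inner_add_right, inner_add_right, inner_add_left, inner_add_left, inner_hlift, hw,
    inner_zero_right, inner_hlift_hlift hp, real_inner_comm (hlift I I' p x z) (oneill hp x _ _),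
    inner_hlift, mfderiv_oneill hp, inner_zero_right, zero_add, add_zero]
  congr 1
  · have h1 := two_mul_inner_leviCivita (mdiffAt_of_smooth hX') (mdiffAt_of_smooth hY')
      (mdiffAt_of_smooth (contMDiffAt_verticalExtend hp ν))
    have hYV : ∀ Y : Π y : N, TangentSpace I' y, ∀ᶠ z in 𝓝 x,
        (inner ℝ (liftField I I' p Y z) (verticalExtend I I' p ν z) : ℝ) = 0 := fun Y ↦
      Eventually.of_forall fun z ↦
        inner_horizontal_vertical (hlift_mem _) (mfderiv_verticalExtend hp ν z)
    have hbr : ∀ X Y : Π y : N, TangentSpace I' y, CMDiffAt ∞ (T% X) (p x) →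
        (inner ℝ (mlieBracket I (liftField I I' p X) (verticalExtend I I' p ν) x)
          (liftField I I' p Y x) : ℝ) = 0 := by
      intro X Y hX
      rw [real_inner_comm, liftField, inner_hlift, mfderiv_mlieBracket_vertical hp hX
        (contMDiffAt_verticalExtend hp ν)
        (Eventually.of_forall fun z ↦ mfderiv_verticalExtend hp ν z), inner_zero_right]
    simp only [koszul] at h1
    rw [hbr X Y hX, hbr Y X hY, mvfderiv_eq_zero (hYV X), mvfderiv_eq_zero (hYV Y),
      mvfderiv_inner_liftField hp hX hY, mfderiv_verticalExtend hp, verticalExtend_self hp hw,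
      mlieBracket_liftField hp hX hY, inner_add_left, inner_hlift, hw, inner_zero_right,
      real_inner_smul_left] at h1
    simp only [map_zero, zero_apply] at h1
    linarith
  · have hZ := contMDiffAt_extend (k := ∞) I' E' z
    have h1 := two_mul_inner_leviCivita (mdiffAt_of_smooth hX') (mdiffAt_of_smooth hY')
      (mdiffAt_of_smooth (contMDiffAt_liftField hp hZ))
    have h2 := two_mul_inner_leviCivita (mdiffAt_of_smooth hX) (mdiffAt_of_smooth hY)
      (mdiffAt_of_smooth hZ)
    rw [koszul_liftField hp hX hY hZ, ← h2] at h1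
    simp only [liftField, extend_apply_self] at h1
    simp only [liftField]
    linarith

end LiftedFields

section ONeillFormulas

variable {E : Type*} [NormedAddCommGroup E] [NormedSpace ℝ E] [FiniteDimensional ℝ E]
  {H : Type*} [TopologicalSpace H] {I : ModelWithCorners ℝ E H}
  {M : Type*} [TopologicalSpace M] [ChartedSpace H M] [IsManifold I ∞ M]
  [RiemannianBundle (fun x : M ↦ TangentSpace I x)]
  [IsContMDiffRiemannianBundle I ∞ E (fun x : M ↦ TangentSpace I x)]
  {E' : Type*} [NormedAddCommGroup E'] [NormedSpace ℝ E'] [FiniteDimensional ℝ E']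
  {H' : Type*} [TopologicalSpace H'] {I' : ModelWithCorners ℝ E' H'}
  {N : Type*} [TopologicalSpace N] [ChartedSpace H' N] [IsManifold I' ∞ N]
  [RiemannianBundle (fun x : N ↦ TangentSpace I' x)]
  [IsContMDiffRiemannianBundle I' ∞ E' (fun x : N ↦ TangentSpace I' x)]
  {p : M → N}

theorem leviCivita_sub {Y Y' : Π x : M, TangentSpace I x} {x : M}
    (hY : MDiffAt (T% Y) x) (hY' : MDiffAt (T% Y') x) :
    leviCivita I M (Y - Y') x = leviCivita I M Y x - leviCivita I M Y' x := by
  rw [eq_sub_iff_add_eq, ← leviCivita_add (mdifferentiableAt_sub_section hY hY') hY',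
    sub_add_cancel]

variable (hp : IsRiemannianSubmersion I I' p)
include hp

/-- O'Neill's tensor evaluated on vector fields of the base. -/
def oneillField (X Y : Π y : N, TangentSpace I' y) (z : M) : TangentSpace I z :=
  oneill hp z (X (p z)) (Y (p z))

theorem eventually_leviCivita_liftField {X Y : Π y : N, TangentSpace I' y} {x : M}
    (hX : ∀ᶠ y in 𝓝 (p x), CMDiffAt ∞ (T% X) y) (hY : ∀ᶠ y in 𝓝 (p x), CMDiffAt ∞ (T% Y) y) :
    ∀ᶠ z in 𝓝 x, leviCivita I M (liftField I I' p Y) z (liftField I I' p X z)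
      = liftField I I' p (fun y ↦ leviCivita I' N Y y (X y)) z + oneillField hp X Y z := by
  filter_upwards [hp.contMDiff.continuous.continuousAt.eventually (hX.and hY)] with z hz
  exact leviCivita_liftField hp hz.1 hz.2

theorem contMDiffAt_oneillField {X Y : Π y : N, TangentSpace I' y} {x : M}
    (hX : ∀ᶠ y in 𝓝 (p x), CMDiffAt ∞ (T% X) y) (hY : ∀ᶠ y in 𝓝 (p x), CMDiffAt ∞ (T% Y) y) :
    CMDiffAt ∞ (T% (oneillField hp X Y)) x := by
  have h1 := contMDiffAt_leviCivita (contMDiffAt_liftField hp hX.self_of_nhds)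
    (contMDiffAt_liftField hp hY.self_of_nhds)
  have h2 := contMDiffAt_liftField hp (contMDiffAt_leviCivita hX.self_of_nhds hY.self_of_nhds)
  refine (h1.sub_section h2).congr_of_eventuallyEq ?_
  filter_upwards [eventually_leviCivita_liftField hp hX hY] with z hz
  rw [Pi.sub_apply, hz, add_sub_cancel_left]

theorem mfderiv_oneillField (X Y : Π y : N, TangentSpace I' y) (z : M) :
    mfderiv I I' p z (oneillField hp X Y z) = 0 :=
  mfderiv_oneill hp _ _

/-- The curvature of the total space of a Riemannian submersion on basic fields. -/
theorem curvatureField_liftField {X Y : Π y : N, TangentSpace I' y} {x : M}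
    (hX : ∀ᶠ y in 𝓝 (p x), CMDiffAt ∞ (T% X) y) (hY : ∀ᶠ y in 𝓝 (p x), CMDiffAt ∞ (T% Y) y) :
    curvatureField (liftField I I' p X) (liftField I I' p Y) (liftField I I' p Y) x
      = hlift I I' p x (curvatureField X Y Y (p x))
        + oneill hp x (X (p x)) (leviCivita I' N Y (p x) (Y (p x)))
        - oneill hp x (Y (p x)) (leviCivita I' N Y (p x) (X (p x)))
        + leviCivita I M (oneillField hp Y X) x (liftField I I' p Y x)
        - oneill hp x (mlieBracket I' X Y (p x)) (Y (p x))
        + (2 : ℝ) • leviCivita I M (liftField I I' p Y) x (oneill hp x (Y (p x)) (X (p x))) := by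
  have := FiniteDimensional.complete ℝ E'
  have hX₀ := hX.self_of_nhds
  have hY₀ := hY.self_of_nhds
  have hX' := contMDiffAt_liftField hp hX₀
  have hY' := contMDiffAt_liftField hp hY₀
  have hYY := contMDiffAt_leviCivita hY₀ hY₀
  have hXY := contMDiffAt_leviCivita hX₀ hY₀
  have hb := contMDiffAt_mlieBracket hX₀ hY₀
  have e1 : ∀ᶠ z in 𝓝 x, leviCivita I M (liftField I I' p Y) z (liftField I I' p Y z)
      = liftField I I' p (fun y ↦ leviCivita I' N Y y (Y y)) z := by
    filter_upwards [eventually_leviCivita_liftField hp hY hY] with z hz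
    rw [hz, oneillField, oneill_self, add_zero]
  have e2 : ∀ᶠ z in 𝓝 x, leviCivita I M (liftField I I' p Y) z (liftField I I' p X z)
      = (liftField I I' p (fun y ↦ leviCivita I' N Y y (X y)) - oneillField hp Y X) z := by
    filter_upwards [eventually_leviCivita_liftField hp hX hY] with z hz
    rw [hz, oneillField, oneill_swap, Pi.sub_apply, sub_eq_add_neg]
    rfl
  have e3 := leviCivita_liftField hp hb hY₀
  rw [liftField] at e3
  simp only [curvatureField]
  rw [leviCivita_congr (mdiffAt_of_smooth (contMDiffAt_leviCivita hY' hY')) e1,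
    leviCivita_congr (mdiffAt_of_smooth (contMDiffAt_leviCivita hX' hY')) e2,
    leviCivita_sub (mdiffAt_of_smooth (contMDiffAt_liftField hp hXY))
      (mdiffAt_of_smooth (contMDiffAt_oneillField hp hY hX)), sub_apply,
    leviCivita_liftField hp hX₀ hYY, leviCivita_liftField hp hY₀ hXY,
    mlieBracket_liftField hp hX₀ hY₀, map_add, e3, map_smul, map_sub, map_sub,
    oneill_swap hp (X (p x)) (Y (p x)), map_neg, smul_neg]
  abel

theorem inner_leviCivita_oneillField {X Y Z : Π y : N, TangentSpace I' y} {x : M}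
    (hX : ∀ᶠ y in 𝓝 (p x), CMDiffAt ∞ (T% X) y) (hY : ∀ᶠ y in 𝓝 (p x), CMDiffAt ∞ (T% Y) y)
    (hZ : ∀ᶠ y in 𝓝 (p x), CMDiffAt ∞ (T% Z) y) {W : Π y : N, TangentSpace I' y}
    (hW : ∀ᶠ y in 𝓝 (p x), CMDiffAt ∞ (T% W) y) :
    (inner ℝ (leviCivita I M (oneillField hp X Y) x (liftField I I' p Z x))
        (liftField I I' p W x) : ℝ)
      = - inner ℝ (oneill hp x (X (p x)) (Y (p x))) (oneill hp x (Z (p x)) (W (p x))) := by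
  rw [inner_leviCivita_of_inner_eq_zero
    (mdiffAt_of_smooth (contMDiffAt_oneillField hp hX hY))
    (mdiffAt_of_smooth (contMDiffAt_liftField hp hW.self_of_nhds)),
    leviCivita_liftField hp hZ.self_of_nhds hW.self_of_nhds, inner_add_right, oneillField,
    real_inner_comm, inner_hlift, mfderiv_oneill hp, inner_zero_right, zero_add]
  refine Eventually.of_forall fun z ↦ ?_
  rw [real_inner_comm]
  exact inner_horizontal_vertical (hlift_mem _) (mfderiv_oneillField hp _ _ z)

theorem inner_leviCivita_liftField_oneill {X Y Z : Π y : N, TangentSpace I' y} {x : M}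
    (hX : ∀ᶠ y in 𝓝 (p x), CMDiffAt ∞ (T% X) y) (hY : ∀ᶠ y in 𝓝 (p x), CMDiffAt ∞ (T% Y) y)
    (hZ : ∀ᶠ y in 𝓝 (p x), CMDiffAt ∞ (T% Z) y) {W : Π y : N, TangentSpace I' y}
    (hW : ∀ᶠ y in 𝓝 (p x), CMDiffAt ∞ (T% W) y) :
    (inner ℝ (leviCivita I M (liftField I I' p Z) x (oneill hp x (X (p x)) (Y (p x))))
        (liftField I I' p W x) : ℝ)
      = - inner ℝ (oneill hp x (X (p x)) (Y (p x))) (oneill hp x (Z (p x)) (W (p x))) := by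
  have hV := contMDiffAt_oneillField hp hX hY
  have h := leviCivita_sub_leviCivita
    (mdiffAt_of_smooth (contMDiffAt_liftField hp hZ.self_of_nhds)) (mdiffAt_of_smooth hV)
  have h0 := mfderiv_mlieBracket_vertical hp hZ.self_of_nhds hV
    (Eventually.of_forall fun z ↦ mfderiv_oneillField hp _ _ z)
  rw [← inner_leviCivita_oneillField hp hX hY hZ hW, ← sub_eq_zero, ← inner_sub_left,
    ← neg_sub, inner_neg_left, neg_eq_zero]
  change (inner ℝ (leviCivita I M (oneillField hp X Y) x (liftField I I' p Z x)
    - leviCivita I M (liftField I I' p Z) x (oneillField hp X Y x)) (liftField I I' p W x) : ℝ) = 0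
  rw [h, real_inner_comm]
  exact inner_horizontal_vertical (hlift_mem _) h0

end ONeillFormulas

section SmoothAlong

variable {E : Type*} [NormedAddCommGroup E] [NormedSpace ℝ E] [FiniteDimensional ℝ E]
  {H : Type*} [TopologicalSpace H] {I : ModelWithCorners ℝ E H}
  {M : Type*} [TopologicalSpace M] [ChartedSpace H M] [IsManifold I ∞ M]

theorem eventually_contMDiffAt_chartFrame (x : M) (i : Fin (Module.finrank ℝ E)) :
    ∀ᶠ y in 𝓝 x, CMDiffAt ∞ (T% (chartFrame I x i)) y := by
  let w := Module.finBasis ℝ E i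
  obtain ⟨s, hs, h⟩ := exists_contMDiffOn_extend (k := ∞) I E (chartField I x w x)
  have e : ∀ᶠ y in 𝓝 x, extend E (chartField I x w x) y = chartField I x w y := by
    filter_upwards [extend_eventuallyEq_chartField (chartField I x w x)] with y hy
    rw [hy, chartCoord_chartField_self]
  filter_upwards [eventually_mem_nhds_iff.2 hs, e.eventually_nhds] with y hy hey
  refine (h.contMDiffAt hy).congr_of_eventuallyEq ?_
  filter_upwards [hey] with z hz
  rw [hz]; rfl

/-- Linear combinations with constant coefficients of vector fields. -/
def constComb {ι : Type*} [Fintype ι] (c : ι → ℝ) (X : ι → Π x : M, TangentSpace I x) (y : M) :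
    TangentSpace I y :=
  ∑ i, c i • X i y

theorem contMDiffAt_sum_smul {ι : Type*} [Fintype ι] {c : ι → M → ℝ}
    {X : ι → Π x : M, TangentSpace I x} {x : M} (hc : ∀ i, CMDiffAt ∞ (c i) x)
    (hX : ∀ i, CMDiffAt ∞ (T% (X i)) x) :
    CMDiffAt ∞ (T% (fun y ↦ ∑ i, c i y • X i y)) x :=
  ContMDiffAt.sum_section fun i _ ↦ (hc i).smul_section (hX i)

theorem contMDiffAt_constComb {ι : Type*} [Fintype ι] (c : ι → ℝ)
    {X : ι → Π x : M, TangentSpace I x} {x : M} (hX : ∀ i, CMDiffAt ∞ (T% (X i)) x) :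
    CMDiffAt ∞ (T% (constComb c X)) x :=
  contMDiffAt_sum_smul (fun _ ↦ contMDiffAt_const) hX

variable (I) in
/-- `V` is a smooth vector field along the curve `q` near `t`, in terms of the coordinate frame
of the preferred chart at `q t`. -/
def SmoothAlongAt (J : Set ℝ) (q : ℝ → M)
    (V : Π t : ℝ, TangentSpace I (q t)) (t : ℝ) : Prop :=
  ∃ c : Fin (Module.finrank ℝ E) → ℝ → ℝ, (∀ i, ContDiffWithinAt ℝ ∞ (c i) J t) ∧
    ∀ᶠ s in 𝓝[J] t, V s = ∑ i, c i s • chartFrame I (q t) i (q s)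

theorem contDiffWithinAt_comp_curve {J : Set ℝ} {q : ℝ → M} {t : ℝ} {φ : M → ℝ}
    (hφ : CMDiffAt ∞ φ (q t)) (hq : ContMDiffWithinAt 𝓘(ℝ, ℝ) I ∞ q J t) :
    ContDiffWithinAt ℝ ∞ (fun s ↦ φ (q s)) J t :=
  contMDiffWithinAt_iff_contDiffWithinAt.1 (hφ.comp_contMDiffWithinAt t hq)

theorem smoothAlongAt_sum {ι : Type*} [Fintype ι] {J : Set ℝ} {q : ℝ → M}
    {V : Π t : ℝ, TangentSpace I (q t)} {t : ℝ} {c : ι → ℝ → ℝ}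
    {X : ι → Π x : M, TangentSpace I x}
    (hV : ∀ᶠ s in 𝓝[J] t, V s = ∑ i, c i s • X i (q s))
    (hc : ∀ i, ContDiffWithinAt ℝ ∞ (c i) J t) (hX : ∀ i, CMDiffAt ∞ (T% (X i)) (q t))
    (hq : ContMDiffWithinAt 𝓘(ℝ, ℝ) I ∞ q J t) : SmoothAlongAt I J q V t := by
  refine ⟨fun k s ↦ ∑ i, c i s * chartComp I (q t) k (q s) (X i (q s)), fun k ↦ ?_, ?_⟩
  · refine ContDiffWithinAt.sum fun i _ ↦ (hc i).mul ?_
    exact contDiffWithinAt_comp_curve (contMDiffAt_chartComp (hX i) k) hq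
  · filter_upwards [hV, hq.continuousWithinAt.eventually (eventually_eq_sum_chartFrame (I := I) (q t))]
      with s hs h
    rw [h (V s), hs]
    simp only [map_sum, map_smul, smul_eq_mul]

theorem SmoothAlongAt.add {J : Set ℝ} {q : ℝ → M} {V W : Π t : ℝ, TangentSpace I (q t)} {t : ℝ}
    (hV : SmoothAlongAt I J q V t) (hW : SmoothAlongAt I J q W t) :
    SmoothAlongAt I J q (fun s ↦ V s + W s) t := by
  obtain ⟨c, hc, h⟩ := hV
  obtain ⟨d, hd, h'⟩ := hW
  refine ⟨fun i s ↦ c i s + d i s, fun i ↦ (hc i).add (hd i), ?_⟩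
  filter_upwards [h, h'] with s hs hs'
  rw [hs, hs', ← Finset.sum_add_distrib]
  simp_rw [add_smul]

theorem hasDerivWithinAt_of_contDiffWithinAt {c : ℝ → ℝ} {J : Set ℝ} {t : ℝ}
    (hc : ContDiffWithinAt ℝ ∞ c J t) : HasDerivWithinAt c (derivWithin c J t) J t :=
  (hc.differentiableWithinAt (by simp)).hasDerivWithinAt

theorem eventually_hasDerivWithinAt {c : ℝ → ℝ} {J : Set ℝ} {t : ℝ} (ht : t ∈ J)
    (hc : ContDiffWithinAt ℝ ∞ c J t) :
    ∀ᶠ s in 𝓝[J] t, HasDerivWithinAt c (derivWithin c J s) J s := by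
  have h1 : ContDiffWithinAt ℝ 1 c J t := hc.of_le (by simp)
  have h2 := h1.eventually (by simp)
  rw [Set.insert_eq_of_mem ht] at h2
  filter_upwards [h2] with s hs
  exact (hs.differentiableWithinAt (by simp)).hasDerivWithinAt

theorem mdifferentiableWithinAt_curve {J : Set ℝ} {q : ℝ → M} {t : ℝ}
    (hq : ContMDiffWithinAt 𝓘(ℝ, ℝ) I ∞ q J t) : MDifferentiableWithinAt 𝓘(ℝ, ℝ) I q J t :=
  hq.mdifferentiableWithinAt (by simp)

theorem smoothAlongAt_velocity {J : Set ℝ} {q : ℝ → M} {t : ℝ}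
    (hq : ContMDiffOn 𝓘(ℝ, ℝ) I ∞ q J) (hJ : UniqueDiffOn ℝ J) (ht : t ∈ J) :
    SmoothAlongAt I J q (velocity I J q) t := by
  let L (i : Fin (Module.finrank ℝ E)) : E →L[ℝ] ℝ :=
    (ContinuousLinearMap.proj (R := ℝ) (φ := fun _ ↦ ℝ) i).comp
      ((Module.finBasis ℝ E).equivFunL : E →L[ℝ] (Fin (Module.finrank ℝ E) → ℝ))
  have hφ (i) : ∀ᶠ y in 𝓝 (q t), CMDiffAt ∞ (fun y ↦ L i (extChartAt I (q t) y)) y := by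
    filter_upwards [(chartAt H (q t)).open_source.mem_nhds (mem_chart_source H (q t))] with y hy
    exact (L i).contMDiff.contMDiffAt.comp y (contMDiffAt_extChartAt' hy)
  refine ⟨fun i s ↦ derivWithin (fun r ↦ L i (extChartAt I (q t) (q r))) J s, fun i ↦ ?_, ?_⟩
  · exact (contDiffWithinAt_comp_curve (hφ i).self_of_nhds (hq t ht)).derivWithin hJ (by simp) ht
  · have hcont := (hq t ht).continuousWithinAt
    filter_upwards [hcont.eventually (eventually_all.2 hφ),
      hcont.eventually (eventually_eq_sum_chartFrame (I := I) (q t)), self_mem_nhdsWithin,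
      hcont.eventually
        ((chartAt H (q t)).open_source.mem_nhds (mem_chart_source H (q t)))] with s hs h hsJ hsc
    rw [h (velocity I J q s)]
    refine Finset.sum_congr rfl fun i _ ↦ ?_
    have hd := hasDerivWithinAt_comp_curve (mdiffAt_of_contMDiffAt (hs i))
      (mdifferentiableWithinAt_curve (hq s hsJ))
    rw [hd.derivWithin (hJ s hsJ)]
    congr 1
    have e : mfderiv I 𝓘(ℝ, ℝ) (fun y ↦ L i (extChartAt I (q t) y)) (q s)
        = (L i).comp (mfderiv I 𝓘(ℝ, E) (extChartAt I (q t)) (q s)) := by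
      have h1 := mfderiv_comp (I := I) (I' := 𝓘(ℝ, E)) (I'' := 𝓘(ℝ, ℝ)) (g := L i) (q s)
        (L i).differentiableAt.mdifferentiableAt
        (mdifferentiableAt_extChartAt (I := I) hsc)
      rw [(L i).mfderiv_eq] at h1
      exact h1
    change L i (chartCoord I (q t) (q s) _)
      = mfderiv I 𝓘(ℝ, ℝ) (fun y ↦ L i (extChartAt I (q t) y)) (q s) (velocity I J q s)
    rw [e, chartCoord, TangentBundle.continuousLinearMapAt_trivializationAt hsc]
    rfl

end SmoothAlong

section CovariantDerivative

variable {E : Type*} [NormedAddCommGroup E] [NormedSpace ℝ E] [FiniteDimensional ℝ E]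
  {H : Type*} [TopologicalSpace H] {I : ModelWithCorners ℝ E H}
  {M : Type*} [TopologicalSpace M] [ChartedSpace H M] [IsManifold I ∞ M]
  [RiemannianBundle (fun x : M ↦ TangentSpace I x)]
  [IsContMDiffRiemannianBundle I ∞ E (fun x : M ↦ TangentSpace I x)]

theorem leviCivita_constComb {ι : Type*} [Fintype ι] (c : ι → ℝ)
    {X : ι → Π x : M, TangentSpace I x} {x : M} (hX : ∀ i, MDiffAt (T% (X i)) x)
    (u : TangentSpace I x) :
    leviCivita I M (constComb c X) x u = ∑ i, c i • leviCivita I M (X i) x u := by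
  have h := leviCivita_sum_smul Finset.univ (c := fun i _ ↦ c i) (X := X) (x := x)
    (fun _ _ ↦ mdifferentiableAt_const) (fun i _ ↦ hX i) u
  refine h.trans (Finset.sum_congr rfl fun i _ ↦ ?_)
  have : mvfderiv I (fun _ : M ↦ c i) x = 0 := mvfderiv_const _
  simp [this]

theorem covDerivAlong_congr {J : Set ℝ} {q : ℝ → M} {V W : Π t : ℝ, TangentSpace I (q t)}
    (h : ∀ s ∈ J, V s = W s) {t : ℝ} (ht : t ∈ J) :
    covDerivAlong I J q V t = covDerivAlong I J q W t := by
  simp only [covDerivAlong]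
  rw [h t ht, derivWithin_congr (fun s hs ↦ by rw [h s hs]) (by rw [h t ht])]

theorem covDerivAlong_zero {J : Set ℝ} {q : ℝ → M} {V : Π t : ℝ, TangentSpace I (q t)}
    (h : ∀ s ∈ J, V s = 0) {t : ℝ} (ht : t ∈ J) (hq : MDifferentiableWithinAt 𝓘(ℝ, ℝ) I q J t)
    (hJ : UniqueDiffWithinAt ℝ J t) : covDerivAlong I J q V t = 0 := by
  rw [covDerivAlong_sum (ι := Empty) (c := fun _ _ ↦ 0) (c' := fun _ ↦ 0) (X := fun i ↦ i.elim)
    ?_ ht (fun i ↦ i.elim) (fun i ↦ i.elim) hq hJ]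
  · simp
  · filter_upwards [self_mem_nhdsWithin] with s hs
    simp [h s hs]

theorem covDerivAlong_add {J : Set ℝ} {q : ℝ → M} {V W : Π t : ℝ, TangentSpace I (q t)} {t : ℝ}
    (hV : SmoothAlongAt I J q V t) (hW : SmoothAlongAt I J q W t) (ht : t ∈ J)
    (hq : MDifferentiableWithinAt 𝓘(ℝ, ℝ) I q J t) (hJ : UniqueDiffWithinAt ℝ J t) :
    covDerivAlong I J q (fun s ↦ V s + W s) t
      = covDerivAlong I J q V t + covDerivAlong I J q W t := by
  obtain ⟨c, hc, h⟩ := hV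
  obtain ⟨d, hd, h'⟩ := hW
  have hX (i) := mdiffAt_of_smooth (contMDiffAt_chartFrame (I := I) (q t) i)
  have hc' (i) := hasDerivWithinAt_of_contDiffWithinAt (hc i)
  have hd' (i) := hasDerivWithinAt_of_contDiffWithinAt (hd i)
  rw [covDerivAlong_sum h ht hc' hX hq hJ, covDerivAlong_sum h' ht hd' hX hq hJ,
    covDerivAlong_sum (c := fun i s ↦ c i s + d i s) ?_ ht (fun i ↦ (hc' i).add (hd' i)) hX hq hJ]
  · simp_rw [add_smul, Finset.sum_add_distrib]
    abel
  · filter_upwards [h, h'] with s hs hs'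
    rw [hs, hs', ← Finset.sum_add_distrib]
    simp_rw [add_smul]

theorem SmoothAlongAt.covDeriv {J : Set ℝ} {q : ℝ → M} {V : Π t : ℝ, TangentSpace I (q t)}
    {t : ℝ} (hV : SmoothAlongAt I J q V t) (hq : ContMDiffOn 𝓘(ℝ, ℝ) I ∞ q J)
    (hJ : UniqueDiffOn ℝ J) (ht : t ∈ J) :
    SmoothAlongAt I J q (covDerivAlong I J q V) t := by
  obtain ⟨c, hc, h⟩ := hV
  obtain ⟨d, hd, h'⟩ := smoothAlongAt_velocity hq hJ ht
  let e (i : Fin (Module.finrank ℝ E)) := chartFrame I (q t) i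
  have he (i) : CMDiffAt ∞ (T% (e i)) (q t) := contMDiffAt_chartFrame (I := I) (q t) i
  have hcont := (hq t ht).continuousWithinAt
  have h1 : SmoothAlongAt I J q (fun s ↦ ∑ i, derivWithin (c i) J s • e i (q s)) t :=
    ⟨fun i ↦ derivWithin (c i) J, fun i ↦ (hc i).derivWithin hJ (by simp) ht,
      Eventually.of_forall fun s ↦ rfl⟩
  let K := Fin (Module.finrank ℝ E) × Fin (Module.finrank ℝ E)
  let Γ (k : K) (y : M) : TangentSpace I y := leviCivita I M (e k.1) y (e k.2 y)
  have hΓ (k : K) : CMDiffAt ∞ (T% (Γ k)) (q t) := contMDiffAt_leviCivita (he k.2) (he k.1)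
  have hcd (k : K) : ContDiffWithinAt ℝ ∞ (fun s ↦ c k.1 s * d k.2 s) J t :=
    (hc k.1).mul (hd k.2)
  have h2 : SmoothAlongAt I J q (fun s ↦ ∑ k : K, (c k.1 s * d k.2 s) • Γ k (q s)) t :=
    smoothAlongAt_sum (Eventually.of_forall fun s ↦ rfl) hcd hΓ (hq t ht)
  obtain ⟨b, hb, h3⟩ := h1.add h2
  refine ⟨b, hb, ?_⟩
  have hh : ∀ᶠ s in 𝓝[J] t, ∀ᶠ r in 𝓝[J] s, V r = ∑ i, c i r • e i (q r) :=
    eventually_eventually_nhdsWithin.2 h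
  filter_upwards [h3, hh, h', eventually_all.2 fun i ↦ eventually_hasDerivWithinAt ht (hc i),
    eventually_all.2 fun i ↦ hcont.eventually (eventually_mdiffAt (he i)),
    self_mem_nhdsWithin] with s hs hVs hus hcs hes hsJ
  rw [← hs, covDerivAlong_sum hVs hsJ hcs hes (mdifferentiableWithinAt_curve (hq s hsJ))
    (hJ s hsJ), hus, Fintype.sum_prod_type]
  simp_rw [map_sum, map_smul, Finset.smul_sum, smul_smul]
  rfl

/-- The components of a vector field along a curve, frozen at time `t`, give a vector field whose
covariant derivative differs from that along the curve by the derivative of the components. -/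
theorem covDerivAlong_eq_constComb {ι : Type*} [Fintype ι] {J : Set ℝ} {q : ℝ → M}
    {V : Π t : ℝ, TangentSpace I (q t)} {t : ℝ} {c : ι → ℝ → ℝ} {c' : ι → ℝ}
    {X : ι → Π x : M, TangentSpace I x}
    (hV : ∀ᶠ s in 𝓝[J] t, V s = ∑ i, c i s • X i (q s)) (ht : t ∈ J)
    (hc : ∀ i, HasDerivWithinAt (c i) (c' i) J t) (hX : ∀ i, MDiffAt (T% (X i)) (q t))
    (hq : MDifferentiableWithinAt 𝓘(ℝ, ℝ) I q J t) (hJ : UniqueDiffWithinAt ℝ J t) :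
    covDerivAlong I J q V t = constComb c' X (q t)
      + leviCivita I M (constComb (fun i ↦ c i t) X) (q t) (velocity I J q t) := by
  rw [covDerivAlong_sum hV ht hc hX hq hJ, leviCivita_constComb _ hX]
  rfl

end CovariantDerivative

section Congruence

variable {E : Type*} [NormedAddCommGroup E] [NormedSpace ℝ E] [FiniteDimensional ℝ E]
  {H : Type*} [TopologicalSpace H] {I : ModelWithCorners ℝ E H}
  {M : Type*} [TopologicalSpace M] [ChartedSpace H M] [IsManifold I ∞ M]
  [RiemannianBundle (fun x : M ↦ TangentSpace I x)]
  [IsContMDiffRiemannianBundle I ∞ E (fun x : M ↦ TangentSpace I x)]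

theorem velocity_heq {J : Set ℝ} {q₁ q₂ : ℝ → M} (h : ∀ s ∈ J, q₁ s = q₂ s) {t : ℝ}
    (ht : t ∈ J) : (velocity I J q₁ t : E) = velocity I J q₂ t := by
  simp only [velocity]
  rw [mfderivWithin_congr h (h t ht)]
  rfl

theorem covDerivAlong_heq {J : Set ℝ} {q₁ q₂ : ℝ → M} (h : ∀ s ∈ J, q₁ s = q₂ s)
    {V₁ : Π t : ℝ, TangentSpace I (q₁ t)} {V₂ : Π t : ℝ, TangentSpace I (q₂ t)}
    (hV : ∀ s ∈ J, (V₁ s : E) = V₂ s) {t : ℝ} (ht : t ∈ J) :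
    (covDerivAlong I J q₁ V₁ t : E) = covDerivAlong I J q₂ V₂ t := by
  let G (x y : M) (v : E) : E :=
    (trivializationAt E (fun x : M ↦ TangentSpace I x) x).continuousLinearMapAt ℝ y v
  let F (x : M) (d v w : E) : E :=
    (trivializationAt E (fun x : M ↦ TangentSpace I x) x).symmL ℝ x d
      + leviCivita I M (extend E (show TangentSpace I x from v)) x w
  change F (q₁ t) (derivWithin (fun s ↦ G (q₁ t) (q₁ s) (V₁ s)) J t) (V₁ t) (velocity I J q₁ t)
    = F (q₂ t) (derivWithin (fun s ↦ G (q₂ t) (q₂ s) (V₂ s)) J t) (V₂ t) (velocity I J q₂ t)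
  have e : derivWithin (fun s ↦ G (q₁ t) (q₁ s) (V₁ s)) J t
      = derivWithin (fun s ↦ G (q₂ t) (q₂ s) (V₂ s)) J t :=
    derivWithin_congr (fun s hs ↦ by rw [h t ht, h s hs, hV s hs]) (by rw [h t ht, hV t ht])
  rw [e, h t ht, hV t ht, velocity_heq h ht]

theorem IsRiemannianCubicOn.congr {J : Set ℝ} {q₁ q₂ : ℝ → M} (hq : IsRiemannianCubicOn I J q₁)
    (h : ∀ s ∈ J, q₁ s = q₂ s) : IsRiemannianCubicOn I J q₂ := by
  refine ⟨hq.contMDiffOn.congr fun s hs ↦ (h s hs).symm, fun t ht ↦ ?_⟩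
  have h0 (s) (hs : s ∈ J) := velocity_heq (I := I) h hs
  have h1 (s) (hs : s ∈ J) := covDerivAlong_heq h h0 hs
  have h2 (s) (hs : s ∈ J) := covDerivAlong_heq h h1 hs
  have h3 (s) (hs : s ∈ J) := covDerivAlong_heq h h2 hs
  let add (u v : E) : E := u + v
  let R (x : M) (u v w : E) : E := curvature I x u v w
  have := hq.eq_zero t ht
  change add (covDerivAlong I J q₁ (covDerivAlong I J q₁ (covDerivAlong I J q₁ (velocity I J q₁))) t)
    (R (q₁ t) (covDerivAlong I J q₁ (velocity I J q₁) t) (velocity I J q₁ t)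
      (velocity I J q₁ t)) = (0 : E) at this
  rw [h3 t ht, h1 t ht, h0 t ht, h t ht] at this
  exact this

end Congruence

section HorizontalCurves

variable {E : Type*} [NormedAddCommGroup E] [NormedSpace ℝ E] [FiniteDimensional ℝ E]
  {H : Type*} [TopologicalSpace H] {I : ModelWithCorners ℝ E H} [I.Boundaryless]
  {M : Type*} [TopologicalSpace M] [T2Space M] [ChartedSpace H M] [IsManifold I ∞ M]
  [RiemannianBundle (fun x : M ↦ TangentSpace I x)]
  [IsContMDiffRiemannianBundle I ∞ E (fun x : M ↦ TangentSpace I x)]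
  {E' : Type*} [NormedAddCommGroup E'] [NormedSpace ℝ E'] [FiniteDimensional ℝ E']
  {H' : Type*} [TopologicalSpace H'] {I' : ModelWithCorners ℝ E' H'} [I'.Boundaryless]
  {N : Type*} [TopologicalSpace N] [T2Space N] [ChartedSpace H' N] [IsManifold I' ∞ N]
  [RiemannianBundle (fun x : N ↦ TangentSpace I' x)]
  [IsContMDiffRiemannianBundle I' ∞ E' (fun x : N ↦ TangentSpace I' x)]
  {p : M → N}

variable (hp : IsRiemannianSubmersion I I' p) {J : Set ℝ} {q : ℝ → M}
include hp

theorem contMDiffOn_comp_curve (hq : ContMDiffOn 𝓘(ℝ, ℝ) I ∞ q J) :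
    ContMDiffOn 𝓘(ℝ, ℝ) I' ∞ (fun s ↦ p (q s)) J :=
  hp.contMDiff.comp_contMDiffOn hq

theorem velocity_eq_hlift {t : ℝ} (hq : ContMDiffWithinAt 𝓘(ℝ, ℝ) I ∞ q J t)
    (hJ : UniqueDiffWithinAt ℝ J t) (h : velocity I J q t ∈ horizontalSpace I I' p (q t)) :
    velocity I J q t = hlift I I' p (q t) (velocity I' J (fun s ↦ p (q s)) t) := by
  rw [← hlift_mfderiv_of_mem hp h]
  congr 1
  have h1 := mfderiv_comp_mfderivWithin t
    (hp.contMDiff.contMDiffAt.mdifferentiableAt (x := q t) (by simp))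
    (mdifferentiableWithinAt_curve hq) hJ.uniqueMDiffWithinAt
  exact (congrArg (fun L ↦ L (1 : ℝ)) h1).symm

theorem liftField_constComb {ι : Type*} [Fintype ι] (c : ι → ℝ)
    (X : ι → Π y : N, TangentSpace I' y) :
    liftField I I' p (constComb c X) = constComb c (fun i ↦ liftField I I' p (X i)) := by
  funext z
  simp [liftField, constComb, map_sum]

theorem smoothAlongAt_hlift {t : ℝ} (hq : ContMDiffWithinAt 𝓘(ℝ, ℝ) I ∞ q J t)
    {V : Π t : ℝ, TangentSpace I' (p (q t))}
    (hV : SmoothAlongAt I' J (fun s ↦ p (q s)) V t) :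
    SmoothAlongAt I J q (fun s ↦ hlift I I' p (q s) (V s)) t := by
  obtain ⟨c, hc, h⟩ := hV
  refine smoothAlongAt_sum (c := c) (X := fun i ↦ liftField I I' p (chartFrame I' (p (q t)) i))
    ?_ hc (fun i ↦ contMDiffAt_liftField hp (contMDiffAt_chartFrame _ i)) hq
  filter_upwards [h] with s hs
  rw [hs, map_sum]
  simp [liftField]

theorem covDerivAlong_hlift {t : ℝ} (ht : t ∈ J) (hq : ContMDiffWithinAt 𝓘(ℝ, ℝ) I ∞ q J t)
    (hJ : UniqueDiffWithinAt ℝ J t) (hh : velocity I J q t ∈ horizontalSpace I I' p (q t))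
    {V : Π t : ℝ, TangentSpace I' (p (q t))}
    (hV : SmoothAlongAt I' J (fun s ↦ p (q s)) V t) :
    covDerivAlong I J q (fun s ↦ hlift I I' p (q s) (V s)) t
      = hlift I I' p (q t) (covDerivAlong I' J (fun s ↦ p (q s)) V t)
        + oneill hp (q t) (velocity I' J (fun s ↦ p (q s)) t) (V t) := by
  obtain ⟨c, hc, h⟩ := hV
  let e (i : Fin (Module.finrank ℝ E')) := chartFrame I' (p (q t)) i
  have he (i) : CMDiffAt ∞ (T% (e i)) (p (q t)) := contMDiffAt_chartFrame (I := I') (p (q t)) i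
  have hc' (i) := hasDerivWithinAt_of_contDiffWithinAt (hc i)
  have hq' : ContMDiffWithinAt 𝓘(ℝ, ℝ) I' ∞ (fun s ↦ p (q s)) J t :=
    hp.contMDiff.contMDiffAt.comp_contMDiffWithinAt t hq
  have h' : ∀ᶠ s in 𝓝[J] t, hlift I I' p (q s) (V s)
      = ∑ i, c i s • liftField I I' p (e i) (q s) := by
    filter_upwards [h] with s hs
    rw [hs, map_sum]
    simp [liftField, e]
  have hVt : V t = constComb (fun i ↦ c i t) e (p (q t)) := h.self_of_nhdsWithin ht
  rw [covDerivAlong_eq_constComb h ht hc' (fun i ↦ mdiffAt_of_smooth (he i))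
      (mdifferentiableWithinAt_curve hq') hJ,
    covDerivAlong_eq_constComb h' ht hc'
      (fun i ↦ mdiffAt_of_smooth (contMDiffAt_liftField hp (he i)))
      (mdifferentiableWithinAt_curve hq) hJ,
    velocity_eq_hlift hp hq hJ hh, ← liftField_constComb hp, ← liftField_constComb hp, hVt]
  let u := velocity I' J (fun s ↦ p (q s)) t
  have hu : extend E' u (p (q t)) = u := extend_apply_self E' u
  have h1 := leviCivita_liftField hp (x := q t) (X := extend E' u)
    (contMDiffAt_extend I' E' u) (contMDiffAt_constComb (fun i ↦ c i t) he)
  rw [liftField, hu] at h1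
  rw [h1, map_add, liftField, add_assoc]

theorem smoothAlongAt_oneill_and_covDerivAlong {t : ℝ} (ht : t ∈ J)
    (hq : ContMDiffWithinAt 𝓘(ℝ, ℝ) I ∞ q J t) (hJ : UniqueDiffWithinAt ℝ J t)
    {V₁ V₂ : Π t : ℝ, TangentSpace I' (p (q t))}
    (hV₁ : SmoothAlongAt I' J (fun s ↦ p (q s)) V₁ t)
    (hV₂ : SmoothAlongAt I' J (fun s ↦ p (q s)) V₂ t) :
    SmoothAlongAt I J q (fun s ↦ oneill hp (q s) (V₁ s) (V₂ s)) t ∧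
    ∃ Y₁ Y₂ : Π y : N, TangentSpace I' y,
      (∀ᶠ y in 𝓝 (p (q t)), CMDiffAt ∞ (T% Y₁) y) ∧
      (∀ᶠ y in 𝓝 (p (q t)), CMDiffAt ∞ (T% Y₂) y) ∧
      Y₁ (p (q t)) = V₁ t ∧ Y₂ (p (q t)) = V₂ t ∧
      covDerivAlong I J q (fun s ↦ oneill hp (q s) (V₁ s) (V₂ s)) t
        = leviCivita I M (oneillField hp Y₁ Y₂) (q t) (velocity I J q t)
          + oneill hp (q t) (covDerivAlong I' J (fun s ↦ p (q s)) V₁ t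
            - leviCivita I' N Y₁ (p (q t)) (velocity I' J (fun s ↦ p (q s)) t)) (V₂ t)
          + oneill hp (q t) (V₁ t) (covDerivAlong I' J (fun s ↦ p (q s)) V₂ t
            - leviCivita I' N Y₂ (p (q t)) (velocity I' J (fun s ↦ p (q s)) t)) := by
  obtain ⟨c, hc, h₁⟩ := hV₁
  obtain ⟨d, hd, h₂⟩ := hV₂
  let e (i : Fin (Module.finrank ℝ E')) := chartFrame I' (p (q t)) i
  have he (i) : ∀ᶠ y in 𝓝 (p (q t)), CMDiffAt ∞ (T% (e i)) y :=
    eventually_contMDiffAt_chartFrame (I := I') (p (q t)) i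
  have he' (i) := mdiffAt_of_smooth (he i).self_of_nhds
  have hcomb (b : Fin (Module.finrank ℝ E') → ℝ) :
      ∀ᶠ y in 𝓝 (p (q t)), CMDiffAt ∞ (T% (constComb b e)) y := by
    filter_upwards [eventually_all.2 he] with y hy
    exact contMDiffAt_constComb b hy
  have hc' (i) := hasDerivWithinAt_of_contDiffWithinAt (hc i)
  have hd' (i) := hasDerivWithinAt_of_contDiffWithinAt (hd i)
  have hq' : ContMDiffWithinAt 𝓘(ℝ, ℝ) I' ∞ (fun s ↦ p (q s)) J t :=
    hp.contMDiff.contMDiffAt.comp_contMDiffWithinAt t hq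
  let K := Fin (Module.finrank ℝ E') × Fin (Module.finrank ℝ E')
  let A (k : K) := oneillField hp (e k.1) (e k.2)
  have hA (k : K) : CMDiffAt ∞ (T% (A k)) (q t) := contMDiffAt_oneillField hp (he k.1) (he k.2)
  have hexp (b b' : Fin (Module.finrank ℝ E') → ℝ) (z : M) :
      oneill hp z (∑ i, b i • e i (p z)) (∑ i, b' i • e i (p z))
        = ∑ k : K, (b k.1 * b' k.2) • A k z := by
    simp only [map_sum, map_smul, LinearMap.sum_apply, LinearMap.smul_apply, Finset.smul_sum,
      smul_smul, A, oneillField, K]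
    rw [Fintype.sum_prod_type]
    refine Eq.trans ?_ Finset.sum_comm
    refine Finset.sum_congr rfl fun j _ ↦ Finset.sum_congr rfl fun i _ ↦ ?_
    rw [mul_comm]
  have hW : ∀ᶠ s in 𝓝[J] t, oneill hp (q s) (V₁ s) (V₂ s)
      = ∑ k : K, (c k.1 s * d k.2 s) • A k (q s) := by
    filter_upwards [h₁, h₂] with s hs hs'
    rw [hs, hs']
    exact hexp _ _ (q s)
  have hVt₁ : V₁ t = constComb (fun i ↦ c i t) e (p (q t)) := h₁.self_of_nhdsWithin ht
  have hVt₂ : V₂ t = constComb (fun i ↦ d i t) e (p (q t)) := h₂.self_of_nhdsWithin ht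
  refine ⟨smoothAlongAt_sum hW (fun k ↦ (hc k.1).mul (hd k.2)) hA hq,
    constComb (fun i ↦ c i t) e, constComb (fun i ↦ d i t) e, hcomb _, hcomb _, hVt₁.symm,
    hVt₂.symm, ?_⟩
  have hf : oneillField hp (constComb (fun i ↦ c i t) e) (constComb (fun i ↦ d i t) e)
      = constComb (fun k : K ↦ c k.1 t * d k.2 t) A := funext fun z ↦ hexp _ _ z
  rw [covDerivAlong_eq_constComb hW ht (fun k ↦ (hc' k.1).mul (hd' k.2))
      (fun k ↦ mdiffAt_of_smooth (hA k)) (mdifferentiableWithinAt_curve hq) hJ,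
    covDerivAlong_eq_constComb h₁ ht hc' he' (mdifferentiableWithinAt_curve hq') hJ,
    covDerivAlong_eq_constComb h₂ ht hd' he' (mdifferentiableWithinAt_curve hq') hJ,
    add_sub_cancel_right, add_sub_cancel_right, hf, hVt₁, hVt₂]
  have e1 := hexp (fun i ↦ derivWithin (c i) J t) (fun i ↦ d i t) (q t)
  have e2 := hexp (fun i ↦ c i t) (fun i ↦ derivWithin (d i) J t) (q t)
  change oneill hp (q t) (constComb (fun i ↦ derivWithin (c i) J t) e (p (q t)))
    (constComb (fun i ↦ d i t) e (p (q t))) = _ at e1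
  change oneill hp (q t) (constComb (fun i ↦ c i t) e (p (q t)))
    (constComb (fun i ↦ derivWithin (d i) J t) e (p (q t))) = _ at e2
  rw [e1, e2, add_assoc, ← Finset.sum_add_distrib, add_comm]
  simp_rw [← add_smul]
  rfl

end HorizontalCurves

section CubicLift

variable {E : Type*} [NormedAddCommGroup E] [NormedSpace ℝ E] [FiniteDimensional ℝ E]
  {H : Type*} [TopologicalSpace H] {I : ModelWithCorners ℝ E H} [I.Boundaryless]
  {M : Type*} [TopologicalSpace M] [T2Space M] [ChartedSpace H M] [IsManifold I ∞ M]
  [RiemannianBundle (fun x : M ↦ TangentSpace I x)]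
  [IsContMDiffRiemannianBundle I ∞ E (fun x : M ↦ TangentSpace I x)]
  {E' : Type*} [NormedAddCommGroup E'] [NormedSpace ℝ E'] [FiniteDimensional ℝ E']
  {H' : Type*} [TopologicalSpace H'] {I' : ModelWithCorners ℝ E' H'} [I'.Boundaryless]
  {N : Type*} [TopologicalSpace N] [T2Space N] [ChartedSpace H' N] [IsManifold I' ∞ N]
  [RiemannianBundle (fun x : N ↦ TangentSpace I' x)]
  [IsContMDiffRiemannianBundle I' ∞ E' (fun x : N ↦ TangentSpace I' x)]
  {p : M → N}

variable (hp : IsRiemannianSubmersion I I' p) {J : Set ℝ} {q : ℝ → M}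
include hp

theorem covDerivAlong_velocity_eq_hlift (hJ : UniqueDiffOn ℝ J)
    (hq : ContMDiffOn 𝓘(ℝ, ℝ) I ∞ q J)
    (hh : ∀ t ∈ J, velocity I J q t ∈ horizontalSpace I I' p (q t)) {t : ℝ} (ht : t ∈ J) :
    covDerivAlong I J q (velocity I J q) t = hlift I I' p (q t)
      (covDerivAlong I' J (fun s ↦ p (q s)) (velocity I' J (fun s ↦ p (q s))) t) := by
  rw [covDerivAlong_congr (fun s hs ↦ velocity_eq_hlift hp (hq s hs) (hJ s hs) (hh s hs)) ht,
    covDerivAlong_hlift hp ht (hq t ht) (hJ t ht) (hh t ht)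
      (smoothAlongAt_velocity (contMDiffOn_comp_curve hp hq) hJ ht), oneill_self, add_zero]

/-- The third covariant derivative of the velocity of a horizontal curve, in terms of the
projected curve and O'Neill's tensor. -/
theorem covDerivAlong_three_velocity (hJ : UniqueDiffOn ℝ J)
    (hq : ContMDiffOn 𝓘(ℝ, ℝ) I ∞ q J)
    (hh : ∀ t ∈ J, velocity I J q t ∈ horizontalSpace I I' p (q t)) {U A : Π t, TangentSpace I' (p (q t))}
    (hU : U = velocity I' J (fun s ↦ p (q s))) (hA : A = covDerivAlong I' J (fun s ↦ p (q s)) U)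
    {t : ℝ} (ht : t ∈ J) :
    covDerivAlong I J q (covDerivAlong I J q (covDerivAlong I J q (velocity I J q))) t
      = hlift I I' p (q t) (covDerivAlong I' J (fun s ↦ p (q s))
          (covDerivAlong I' J (fun s ↦ p (q s)) A) t)
        + oneill hp (q t) (U t) (covDerivAlong I' J (fun s ↦ p (q s)) A t)
        + covDerivAlong I J q (fun s ↦ oneill hp (q s) (U s) (A s)) t := by
  have hpq := contMDiffOn_comp_curve hp hq
  have sU (s) (hs : s ∈ J) : SmoothAlongAt I' J (fun s ↦ p (q s)) U s := by
    rw [hU]; exact smoothAlongAt_velocity hpq hJ hs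
  have sA (s) (hs : s ∈ J) : SmoothAlongAt I' J (fun s ↦ p (q s)) A s := by
    rw [hA]; exact (sU s hs).covDeriv hpq hJ hs
  have sB (s) (hs : s ∈ J) := (sA s hs).covDeriv hpq hJ hs
  have h1 (s) (hs : s ∈ J) : covDerivAlong I J q (velocity I J q) s = hlift I I' p (q s) (A s) := by
    rw [covDerivAlong_velocity_eq_hlift hp hJ hq hh hs, hA, hU]
  have h2 (s) (hs : s ∈ J) : covDerivAlong I J q (covDerivAlong I J q (velocity I J q)) s
      = hlift I I' p (q s) (covDerivAlong I' J (fun s ↦ p (q s)) A s)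
        + oneill hp (q s) (U s) (A s) := by
    rw [covDerivAlong_congr h1 hs,
      covDerivAlong_hlift hp hs (hq s hs) (hJ s hs) (hh s hs) (sA s hs), hU]
  rw [covDerivAlong_congr h2 ht,
    covDerivAlong_add (smoothAlongAt_hlift hp (hq t ht) (sB t ht))
      (smoothAlongAt_oneill_and_covDerivAlong hp ht (hq t ht) (hJ t ht) (sU t ht) (sA t ht)).1 ht
      (mdifferentiableWithinAt_curve (hq t ht)) (hJ t ht),
    covDerivAlong_hlift hp ht (hq t ht) (hJ t ht) (hh t ht) (sB t ht), hU]

/-- If the projected curve is a cubic, then the left-hand side of the cubic equation of a horizontal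
curve is `2 • (DW + ∇_W Y)`, where `W` is half the vertical bracket of velocity and acceleration. -/
theorem exists_cubic_eq (hJ : UniqueDiffOn ℝ J) (hq : ContMDiffOn 𝓘(ℝ, ℝ) I ∞ q J)
    (hh : ∀ t ∈ J, velocity I J q t ∈ horizontalSpace I I' p (q t)) {U A : Π t, TangentSpace I' (p (q t))}
    (hU : U = velocity I' J (fun s ↦ p (q s))) (hA : A = covDerivAlong I' J (fun s ↦ p (q s)) U)
    {t : ℝ} (ht : t ∈ J) :
    ∃ Y : Π x : M, TangentSpace I x,
      covDerivAlong I J q (covDerivAlong I J q (covDerivAlong I J q (velocity I J q))) t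
        + curvature I (q t) (covDerivAlong I J q (velocity I J q) t) (velocity I J q t)
          (velocity I J q t)
      = hlift I I' p (q t) (covDerivAlong I' J (fun s ↦ p (q s))
          (covDerivAlong I' J (fun s ↦ p (q s)) A) t + curvature I' (p (q t)) (A t) (U t) (U t))
        + (2 : ℝ) • (covDerivAlong I J q (fun s ↦ oneill hp (q s) (U s) (A s)) t
          + leviCivita I M Y (q t) (oneill hp (q t) (U t) (A t))) ∧
      (inner ℝ (covDerivAlong I J q (fun s ↦ oneill hp (q s) (U s) (A s)) t
          + leviCivita I M Y (q t) (oneill hp (q t) (U t) (A t))) (hlift I I' p (q t) (A t)) : ℝ)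
        = - (2 * inner ℝ (oneill hp (q t) (U t) (A t)) (oneill hp (q t) (U t) (A t))) := by
  have hpq := contMDiffOn_comp_curve hp hq
  have sU : SmoothAlongAt I' J (fun s ↦ p (q s)) U t := by
    rw [hU]; exact smoothAlongAt_velocity hpq hJ ht
  have sA : SmoothAlongAt I' J (fun s ↦ p (q s)) A t := by
    rw [hA]; exact sU.covDeriv hpq hJ ht
  obtain ⟨-, Y, X, hY, hX, hYt, hXt, hW⟩ :=
    smoothAlongAt_oneill_and_covDerivAlong hp ht (hq t ht) (hJ t ht) sU sA
  have hv : velocity I J q t = liftField I I' p Y (q t) := by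
    rw [liftField, hYt, hU, ← velocity_eq_hlift hp (hq t ht) (hJ t ht) (hh t ht)]
  have ha : covDerivAlong I J q (velocity I J q) t = liftField I I' p X (q t) := by
    rw [liftField, hXt, covDerivAlong_velocity_eq_hlift hp hJ hq hh ht, hA, hU]
  rw [← hA, ← hU, hv, ← hYt, ← hXt] at hW
  refine ⟨liftField I I' p Y, ?_, ?_⟩
  · have hX₀ := hX.self_of_nhds
    have hY₀ := hY.self_of_nhds
    have hX' := contMDiffAt_liftField hp hX₀
    have hY' := contMDiffAt_liftField hp hY₀
    have hb := leviCivita_sub_leviCivita (mdiffAt_of_smooth hX₀) (mdiffAt_of_smooth hY₀)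
    rw [covDerivAlong_three_velocity hp hJ hq hh hU hA ht, ha, hv,
      curvature_eq_curvatureField hX' hY' hY', curvatureField_liftField hp hX hY, ← hYt, ← hXt,
      curvature_eq_curvatureField hX₀ hY₀ hY₀, hW, ← hb]
    simp only [map_add, map_sub, LinearMap.sub_apply, oneill_self,
      oneill_swap hp (leviCivita I' N Y (p (q t)) (X (p (q t)))) (Y (p (q t))),
      oneill_swap hp (leviCivita I' N X (p (q t)) (Y (p (q t)))) (Y (p (q t))),
      oneill_swap hp (leviCivita I' N Y (p (q t)) (Y (p (q t)))) (X (p (q t)))]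
    module
  · have e1 := inner_leviCivita_oneillField hp hY hX hY hX
    have e2 := inner_leviCivita_liftField_oneill hp hY hX hY hX
    have e3 (u v : TangentSpace I' (p (q t))) :
        (inner ℝ (oneill hp (q t) u v) (liftField I I' p X (q t)) : ℝ) = 0 := by
      rw [real_inner_comm]
      exact inner_horizontal_vertical (hlift_mem _) (mfderiv_oneill hp _ _)
    have e4 : hlift I I' p (q t) (A t) = liftField I I' p X (q t) := by rw [liftField, hXt]
    rw [e4, ← hYt, ← hXt, hW, inner_add_left, inner_add_left, inner_add_left, e1, e2, e3, e3]
    ring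

end CubicLift

end RiemCubic

end

open RiemCubic

theorem theorem5p4
    {E : Type*} [NormedAddCommGroup E] [NormedSpace ℝ E] [FiniteDimensional ℝ E]
    {H : Type*} [TopologicalSpace H] (I : ModelWithCorners ℝ E H) [I.Boundaryless]
    {M : Type*} [TopologicalSpace M] [T2Space M] [ChartedSpace H M] [IsManifold I ∞ M]
    [RiemannianBundle (fun x : M ↦ TangentSpace I x)]
    [IsContMDiffRiemannianBundle I ∞ E (fun x : M ↦ TangentSpace I x)]
    {E' : Type*} [NormedAddCommGroup E'] [NormedSpace ℝ E'] [FiniteDimensional ℝ E']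
    {H' : Type*} [TopologicalSpace H'] (I' : ModelWithCorners ℝ E' H') [I'.Boundaryless]
    {N : Type*} [TopologicalSpace N] [T2Space N] [ChartedSpace H' N] [IsManifold I' ∞ N]
    [RiemannianBundle (fun x : N ↦ TangentSpace I' x)]
    [IsContMDiffRiemannianBundle I' ∞ E' (fun x : N ↦ TangentSpace I' x)]
    (p : M → N) (hp : IsRiemannianSubmersion I I' p)
    (J : Set ℝ) (hJ : J.OrdConnected) (hJ' : J.Nontrivial)
    (q : ℝ → N) (hq : IsRiemannianCubicOn I' J q)
    (q' : ℝ → M) (hq' : IsHorizontalLiftOn I I' p J q q') :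
    (∀ t ∈ J, covDerivAlong I J q' (velocity I J q') t ∈ horizontalSpace I I' p (q' t)) ∧
    (IsRiemannianCubicOn I J q' ↔
      ∀ t ∈ J, verticalBracket I I' p (q' t) (velocity I J q' t)
        (covDerivAlong I J q' (velocity I J q') t) = 0) := by
  have hu : UniqueDiffOn ℝ J := by
    refine uniqueDiffOn_convex hJ.convex ?_
    obtain ⟨a, ha, b, hb, hab⟩ := hJ'.exists_lt
    exact ⟨(a + b) / 2, interior_mono (hJ.out ha hb) (by rw [interior_Icc]; constructor <;> linarith)⟩
  have hsm := hq'.contMDiffOn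
  have hh := hq'.horizontal
  have hN : IsRiemannianCubicOn I' J (fun s ↦ p (q' s)) := hq.congr fun s hs ↦ (hq'.lift s hs).symm
  obtain ⟨U, hU⟩ : ∃ U, U = velocity I' J (fun s ↦ p (q' s)) := ⟨_, rfl⟩
  obtain ⟨A, hA⟩ : ∃ A, A = covDerivAlong I' J (fun s ↦ p (q' s)) U := ⟨_, rfl⟩
  have ha (t) (ht : t ∈ J) : covDerivAlong I J q' (velocity I J q') t
      = hlift I I' p (q' t) (A t) := by
    rw [covDerivAlong_velocity_eq_hlift hp hu hsm hh ht, hA, hU]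
  have hv (t) (ht : t ∈ J) : velocity I J q' t = hlift I I' p (q' t) (U t) := by
    rw [velocity_eq_hlift hp (hsm t ht) (hu t ht) (hh t ht), hU]
  have hW (t) (ht : t ∈ J) : verticalBracket I I' p (q' t) (velocity I J q' t)
      (covDerivAlong I J q' (velocity I J q') t) = 0 ↔ oneill hp (q' t) (U t) (A t) = 0 := by
    rw [ha t ht, hv t ht, oneill_eq_zero_iff hp]
  have key (t) (ht : t ∈ J) := exists_cubic_eq hp hu hsm hh hU hA ht
  have hN0 (t) (ht : t ∈ J) : covDerivAlong I' J (fun s ↦ p (q' s))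
      (covDerivAlong I' J (fun s ↦ p (q' s)) A) t + curvature I' (p (q' t)) (A t) (U t) (U t)
      = 0 := by
    rw [hA, hU]; exact hN.eq_zero t ht
  refine ⟨fun t ht ↦ by rw [ha t ht]; exact hlift_mem _, fun hc t ht ↦ ?_, fun h ↦ ⟨hsm, fun t ht ↦ ?_⟩⟩
  · obtain ⟨Y, h1, h2⟩ := key t ht
    rw [hc.eq_zero t ht, hN0 t ht, map_zero, zero_add, eq_comm, smul_eq_zero_iff_right two_ne_zero]
      at h1
    rw [h1, inner_zero_left] at h2
    rw [hW t ht, ← inner_self_eq_zero (𝕜 := ℝ)]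
    linarith
  · obtain ⟨Y, h1, -⟩ := key t ht
    rw [h1, hN0 t ht, (hW t ht).1 (h t ht), covDerivAlong_zero (fun s hs ↦ (hW s hs).1 (h s hs)) ht
      ((hsm t ht).mdifferentiableWithinAt (by simp)) (hu t ht)]
    simp
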